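/- Let $p\ge 0$ be an integer and let $\Lambda:\mathbb R\to\mathbb R$ be a continuous function with the (asymptotic, not necessarily convergent) expansions $$\Lambda(x)\sim x^{p}\sum_{n=0}^{\infty}\frac{\Lambda_n^{\pm}}{x^{n}},\qquad x\to\pm\infty,$$ i.e. $\Lambda(x)-x^p\sum_{n=0}^{N-1}\Lambda^\pm_n x^{-n}=O(|x|^{p-N})$ as $x\to\pm\infty$ for every $N\ge 0$. For $x\in\mathbb R$, $t>0$ let $$u(x,t)=\frac{1}{2\sqrt{\pi t}}\int_{-\infty}^{+\infty}\Lambda(s)\,e^{-(s-x)^2/(4t)}\,ds,\qquad \eta=\frac{x}{2\sqrt t},\qquad \operatorname{erfc}(y)=\frac1{\sqrt\pi}\int_y^{+\infty}e^{-s^2}\,ds .$$ Then the integral converges absolutely, and $u$ is a classical solution of the Cauchy problem $u_t=u_{xx}$ $(t>0)$, $u(x,0)=\Lambda(x)$, the initial value being attained as $\lim_{(y,t)\to(x,0+)}u(y,t)=\Lambda(x)$. As $|x|+t\to\infty$, $t>0$, it has the uniform asymptotic expansion $$u(x,t)\sim\sum_{m=0}^{p}t^{m/2}\Big[\Lambda^-_{p-m}\Pi^-_m(\eta)\operatorname{erfc}(\eta)+\Lambda^+_{p-m}\Pi^+_m(\eta)\operatorname{erfc}(-\eta)+P_{m-1}(\eta)e^{-\eta^2}\Big]+\sum_{n=1}^{\infty}t^{-n/2}\big(G_{n,0}(\eta)+G_{n,1}(\eta)\ln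 t\big),$$ in the sense that for every $N\ge0$ the difference between $u(x,t)$ and the right-hand side with the last sum truncated at $n=N$ is $o\big((x^2+t)^{-N/2}\big)$ as $|x|+t\to\infty$, uniformly in $t>0$. Here $\Pi_m^\pm$ are polynomials of degree exactly $m$ with absolute constant coefficients (they depend only on $m$, not on $p$ or $\Lambda$); $P_{-1}=0$ and, for $1\le m\le p$, $P_{m-1}$ is a polynomial of degree at most $m-1$, and of degree exactly $m-1$ whenever $\Lambda^+_{p-m}\ne\Lambda^-_{p-m}$; and $G_{n,0},G_{n,1}$ are $C^\infty$ functions on $\mathbb R$. The $P_{m-1}$ and $G_{n,k}$ may depend on $p$ and $\Lambda$, but not on $x$, $t$ or $N$. -/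

import Mathlib

open MeasureTheory Filter Topology Set Asymptotics
open scoped Polynomial ContDiff

noncomputable section

namespace HeatAsymptotics

/-- The complementary error function normalised by `1 / √π` (half of the usual one):
`erfc x = (1 / √π) ∫_x^∞ exp (-s ^ 2) ds`. -/
def erfc (x : ℝ) : ℝ :=
  1 / Real.sqrt Real.pi * ∫ s in Ioi x, Real.exp (-s ^ 2)

/-- The heat convolution
`u(x, t) = 1 / (2 √(π t)) ∫ Λ(s) exp (-(s - x) ^ 2 / (4 t)) ds`, for `t > 0`. -/
def heatConv (Λ : ℝ → ℝ) (x t : ℝ) : ℝ :=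
  1 / (2 * Real.sqrt (Real.pi * t)) * ∫ s : ℝ, Λ s * Real.exp (-(s - x) ^ 2 / (4 * t))

/-- `u` (a function of `x` and of `t > 0`) is a classical solution of the Cauchy problem
`u_t = u_xx` for `t > 0`, with `u(y, t) → Λ(x)` as `(y, t) → (x, 0+)`. -/
structure IsHeatSolution (Λ : ℝ → ℝ) (u : ℝ → ℝ → ℝ) : Prop where
  heat_eq : ∀ t : ℝ, 0 < t → ∃ ux uxx : ℝ → ℝ, ∀ x : ℝ,
    HasDerivAt (fun y => u y t) (ux x) x ∧
    HasDerivAt ux (uxx x) x ∧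
    HasDerivAt (fun τ => u x τ) (uxx x) t
  initial : ∀ x : ℝ,
    Tendsto (fun q : ℝ × ℝ => u q.1 q.2) (𝓝 x ×ˢ 𝓝[>] (0 : ℝ)) (𝓝 (Λ x))

/-- The asymptotic (in general divergent) power expansion
`Λ(x) ~ x ^ p ∑ₙ a n / x ^ n` along the filter `l` (used with `atTop` and `atBot`). -/
def HasPowerExpansion (l : Filter ℝ) (p : ℕ) (a : ℕ → ℝ) (Λ : ℝ → ℝ) : Prop :=
  ∀ N : ℕ, (fun x => Λ x - x ^ p * ∑ n ∈ Finset.range N, a n / x ^ n)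
    =O[l] (fun x => x ^ p / x ^ N)

/-- The limiting process `|x| + t → ∞` in the open half-plane `t > 0` of points `(x, t)`. -/
def spaceTimeInfinity : Filter (ℝ × ℝ) :=
  comap (fun q : ℝ × ℝ => |q.1| + q.2) atTop ⊓ 𝓟 {q : ℝ × ℝ | 0 < q.2}

/-- The self-similar variable `η = x / (2 √t)`. -/
def selfSim (x t : ℝ) : ℝ := x / (2 * Real.sqrt t)

/-- The part of the expansion with nonnegative powers of `t`:
`∑_{m=0}^p t^{m/2} [a⁻_{p-m} Π⁻_m(η) erfc(η) + a⁺_{p-m} Π⁺_m(η) erfc(-η) + P_{m-1}(η) e^{-η²}]`.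
The polynomial `P_{m-1}` is written `P m`. -/
def leadingPart (p : ℕ) (aMinus aPlus : ℕ → ℝ) (PiMinus PiPlus P : ℕ → ℝ[X])
    (x t : ℝ) : ℝ :=
  ∑ m ∈ Finset.range (p + 1), t ^ ((m : ℝ) / 2) *
    (aMinus (p - m) * (PiMinus m).eval (selfSim x t) * erfc (selfSim x t)
      + aPlus (p - m) * (PiPlus m).eval (selfSim x t) * erfc (-selfSim x t)
      + (P m).eval (selfSim x t) * Real.exp (-selfSim x t ^ 2))

/-- The partial sum `∑_{n=1}^N t^{-n/2} (G_{n,0}(η) + G_{n,1}(η) ln t)`. -/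
def decayingPart (G0 G1 : ℕ → ℝ → ℝ) (N : ℕ) (x t : ℝ) : ℝ :=
  ∑ n ∈ Finset.Icc 1 N, t ^ (-(n : ℝ) / 2) *
    (G0 n (selfSim x t) + G1 n (selfSim x t) * Real.log t)

end HeatAsymptotics

end

namespace HeatAsymptotics

/-! Write u as the sum of the contributions of the two half-lines, and put r = 2√t, so that each
contribution is an integral over s > 0 against exp(-(η - s/r)²). On s > 0 split Λ into the
polynomial ∑ a_{p-m} s^m and a remainder R ~ ∑ b_l s^{-(l+1)}. The polynomial produces Gaussian
moments of s₊^m, which a two-term recurrence expresses through erfc and the Gaussian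
(`gaussMoment_eq`); this is the leading part.

For R, integrate by parts with the antiderivative that vanishes at 0. It equals `tailPrimitive R b`,
which decays at infinity, plus b₀ log s + γ. By scaling, the last two terms contribute exactly a
power of 1/r times G₀(η) + G₁(η) log r, while the decaying primitive lies again in the class
`PowerTail`, so the step can be repeated. Hence `PowerTail.exists_expansion` is an identity, with
remainder r^{-(N+1)} ∫ g^{(N)}(η - s/r) R_N(s) ds, where g is the Gaussian and R_N the N-th decaying
primitive. The bound s^{-1/2} in `PowerTail` absorbs the logarithm that a primitive may have at 0
and still is integrable there.

By `PowerTail.exists_abs_remainder_le` the remainder is O((x² + 4t)^{-(N/2 + 1/4)}). Where s/r stays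
away from η the kernel has Gaussian decay in η, and the bound s^{-1/2} suffices. Near s = x > 0 with
t much smaller than x² the factor r^{-(N+1)} is too large, so there the integrations by parts are
undone on s > x/2: the derivatives return to R minus its first N terms, which is O(x^{-(N+1)}), and
the boundary terms at x/2 are Gaussian small.

The negative half-line follows by reflection, and the parity of the moment polynomials gives both
sides the same Π_m and the factor a⁺ - a⁻ in P_{m-1}. The heat equation and the initial value come
from differentiation under the integral and dominated convergence. -/

/-! ### Derivatives of the Gaussian -/

/-- The polynomials with `dⁿ/dyⁿ exp (-y²) = gaussPoly n (y) exp (-y²)`. -/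
noncomputable def gaussPoly : ℕ → ℝ[X]
  | 0 => 1
  | n + 1 => Polynomial.derivative (gaussPoly n) - Polynomial.C 2 * Polynomial.X * gaussPoly n

/-- The `n`-th derivative of `exp (-y²)`. -/
noncomputable def gaussDeriv (n : ℕ) (y : ℝ) : ℝ := (gaussPoly n).eval y * Real.exp (-y ^ 2)

lemma gaussDeriv_zero (y : ℝ) : gaussDeriv 0 y = Real.exp (-y ^ 2) := by
  simp [gaussDeriv, gaussPoly]

lemma hasDerivAt_gaussDeriv (n : ℕ) (y : ℝ) :
    HasDerivAt (gaussDeriv n) (gaussDeriv (n + 1) y) y := by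
  have h1 := (gaussPoly n).hasDerivAt y
  have h2 : HasDerivAt (fun y : ℝ => Real.exp (-y ^ 2)) (Real.exp (-y ^ 2) * (-(2 * y))) y := by
    simpa using ((hasDerivAt_pow 2 y).neg).exp
  refine (h1.mul h2).congr_deriv ?_
  simp only [gaussDeriv, gaussPoly, Polynomial.eval_sub, Polynomial.eval_mul, Polynomial.eval_C,
    Polynomial.eval_X]
  ring

lemma continuous_gaussDeriv (n : ℕ) : Continuous (gaussDeriv n) :=
  continuous_iff_continuousAt.2 fun y => (hasDerivAt_gaussDeriv n y).continuousAt

lemma exists_abs_pow_le_exp_sq (k : ℕ) {c : ℝ} (hc : 0 < c) :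
    ∃ C : ℝ, 0 ≤ C ∧ ∀ y : ℝ, |y| ^ k ≤ C * Real.exp (c * y ^ 2) := by
  -- One term of the exponential series controls |y|^{2k}; then `a ≤ 1 + a ^ 2` with a = |y|^k.
  refine ⟨1 + k.factorial / c ^ k, by positivity, fun y => ?_⟩
  have h1 : (c * y ^ 2) ^ k / k.factorial ≤ Real.exp (c * y ^ 2) :=
    Real.pow_div_factorial_le_exp _ (by positivity) k
  have h2 : (|y| ^ k) ^ 2 ≤ k.factorial / c ^ k * Real.exp (c * y ^ 2) := by
    calc (|y| ^ k) ^ 2 = k.factorial / c ^ k * ((c * y ^ 2) ^ k / k.factorial) := by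
          rw [← pow_mul, mul_comm k 2, pow_mul, sq_abs, mul_pow]
          field_simp
      _ ≤ _ := by gcongr
  have h3 : 1 ≤ Real.exp (c * y ^ 2) := Real.one_le_exp (by positivity)
  nlinarith [sq_nonneg (|y| ^ k - 1)]

lemma exists_abs_eval_le_exp_sq (q : ℝ[X]) {c : ℝ} (hc : 0 < c) :
    ∃ C : ℝ, 0 ≤ C ∧ ∀ y : ℝ, |q.eval y| ≤ C * Real.exp (c * y ^ 2) := by
  induction q using Polynomial.induction_on' with
  | add p q hp hq =>
    obtain ⟨C, hC, h⟩ := hp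
    obtain ⟨D, hD, h'⟩ := hq
    refine ⟨C + D, by positivity, fun y => ?_⟩
    rw [Polynomial.eval_add, add_mul]
    exact (abs_add_le _ _).trans (add_le_add (h y) (h' y))
  | monomial n a =>
    obtain ⟨C, hC, h⟩ := exists_abs_pow_le_exp_sq n hc
    refine ⟨|a| * C, by positivity, fun y => ?_⟩
    rw [Polynomial.eval_monomial, abs_mul, abs_pow, mul_assoc]
    exact mul_le_mul_of_nonneg_left (h y) (abs_nonneg a)

lemma exists_abs_gaussDeriv_le (n : ℕ) :
    ∃ C : ℝ, 0 ≤ C ∧ ∀ y : ℝ, |gaussDeriv n y| ≤ C * Real.exp (-(1 / 2) * y ^ 2) := by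
  obtain ⟨C, hC, h⟩ := exists_abs_eval_le_exp_sq (gaussPoly n) (c := 1 / 2) (by norm_num)
  refine ⟨C, hC, fun y => ?_⟩
  rw [gaussDeriv, abs_mul, Real.abs_exp]
  calc _ ≤ C * Real.exp (1 / 2 * y ^ 2) * Real.exp (-y ^ 2) := by gcongr; exact h y
    _ = _ := by rw [mul_assoc, ← Real.exp_add]; ring_nf

/-! ### Functions integrable against all Gaussians -/

/-- `h` is integrable against every Gaussian `exp (-c s²)`, `c > 0`. -/
def GaussIntegrable (h : ℝ → ℝ) (μ : Measure ℝ) : Prop :=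
  ∀ c : ℝ, 0 < c → Integrable (fun s => h s * Real.exp (-c * s ^ 2)) μ

namespace GaussIntegrable

variable {h g : ℝ → ℝ} {μ ν : Measure ℝ}

lemma add (hh : GaussIntegrable h μ) (hg : GaussIntegrable g μ) :
    GaussIntegrable (fun s => h s + g s) μ := fun c hc => by
  simp only [add_mul]
  exact (hh c hc).add (hg c hc)

lemma const_mul (hh : GaussIntegrable h μ) (a : ℝ) :
    GaussIntegrable (fun s => a * h s) μ := fun c hc => by
  simpa only [mul_assoc] using (hh c hc).const_mul a

lemma mono_measure (hh : GaussIntegrable h μ) (hν : ν ≤ μ) : GaussIntegrable h ν :=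
  fun c hc => (hh c hc).mono_measure hν

lemma mono (hg : GaussIntegrable g μ) (hm : AEStronglyMeasurable h μ)
    (hle : ∀ᵐ s ∂μ, |h s| ≤ g s) : GaussIntegrable h μ := fun c hc => by
  refine (hg c hc).mono (hm.mul (by fun_prop)) ?_
  filter_upwards [hle] with s hs
  rw [norm_mul, norm_mul, Real.norm_eq_abs, Real.norm_eq_abs]
  gcongr
  exact hs.trans (le_abs_self _)

lemma aestronglyMeasurable (hh : GaussIntegrable h μ) : AEStronglyMeasurable h μ := by
  have h1 := (hh 1 one_pos).aestronglyMeasurable.mul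
    (show AEStronglyMeasurable (fun s : ℝ => Real.exp (s ^ 2)) μ by fun_prop)
  refine h1.congr (ae_of_all _ fun s => ?_)
  simp only [Pi.mul_apply, mul_assoc, ← Real.exp_add]
  simp

lemma neg_sq_sub_le (η s : ℝ) : -(η - s) ^ 2 ≤ η ^ 2 - s ^ 2 / 2 := by
  nlinarith [sq_nonneg (2 * η - s)]

/-- Completing the square dominates the shifted kernel by a wider Gaussian centred at the origin. -/
lemma integrable_kernel (hh : GaussIntegrable h μ) (k : ℕ) (η : ℝ) {r : ℝ} (hr : 0 < r) :
    Integrable (fun s => gaussDeriv k (η - s / r) * h s) μ := by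
  obtain ⟨C, hC, hb⟩ := exists_abs_gaussDeriv_le k
  refine ((hh (1 / (4 * r ^ 2)) (by positivity)).norm.const_mul
    (C * Real.exp (η ^ 2 / 2))).mono
    (((continuous_gaussDeriv k).comp (by fun_prop)).aestronglyMeasurable.mul
      hh.aestronglyMeasurable) (ae_of_all _ fun s => ?_)
  simp only [norm_mul, Real.norm_eq_abs, Real.abs_exp, abs_of_nonneg hC, abs_abs]
  calc _ ≤ C * Real.exp (-(1 / 2) * (η - s / r) ^ 2) * |h s| := by gcongr; exact hb _
    _ ≤ C * Real.exp (η ^ 2 / 2 + -(1 / (4 * r ^ 2)) * s ^ 2) * |h s| := by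
        gcongr
        have := neg_sq_sub_le η (s / r)
        have e : (s / r) ^ 2 / 4 = 1 / (4 * r ^ 2) * s ^ 2 := by field_simp
        linarith
    _ = _ := by rw [Real.exp_add]; ring

lemma hasDerivAt_integral (hh : GaussIntegrable h μ) (k : ℕ) (η : ℝ) :
    HasDerivAt (fun η => ∫ s, gaussDeriv k (η - s) * h s ∂μ)
      (∫ s, gaussDeriv (k + 1) (η - s) * h s ∂μ) η := by
  obtain ⟨C, hC, hb⟩ := exists_abs_gaussDeriv_le (k + 1)
  have hi : ∀ k η, Integrable (fun s => gaussDeriv k (η - s) * h s) μ := fun k η => by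
    simpa using hh.integrable_kernel k η one_pos
  refine (hasDerivAt_integral_of_dominated_loc_of_deriv_le
    (F' := fun η s => gaussDeriv (k + 1) (η - s) * h s)
    (bound := fun s => C * Real.exp ((|η| + 1) ^ 2 / 2) * ‖h s * Real.exp (-(1 / 4) * s ^ 2)‖)
    (Metric.ball_mem_nhds η one_pos)
    (Eventually.of_forall fun η => (hi k η).aestronglyMeasurable) (hi k η)
    (hi (k + 1) η).aestronglyMeasurable (ae_of_all _ fun s y hy => ?_)
    ((hh (1 / 4) (by norm_num)).norm.const_mul _) (ae_of_all _ fun s y _ => ?_)).2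
  · rw [norm_mul, norm_mul, Real.norm_eq_abs, Real.norm_eq_abs, Real.norm_eq_abs, Real.abs_exp]
    have hy' : |y| ≤ |η| + 1 := by
      have h1 : |y - η| < 1 := by simpa [Real.dist_eq] using hy
      have h2 := abs_sub_abs_le_abs_sub y η
      linarith
    have hy2 : y ^ 2 ≤ (|η| + 1) ^ 2 := by
      rw [← sq_abs y]; gcongr
    calc _ ≤ C * Real.exp (-(1 / 2) * (y - s) ^ 2) * |h s| := by gcongr; exact hb _
      _ ≤ C * Real.exp ((|η| + 1) ^ 2 / 2 + -(1 / 4) * s ^ 2) * |h s| := by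
          gcongr
          have := neg_sq_sub_le y s
          linarith
      _ = _ := by rw [Real.exp_add]; ring
  · have := (hasDerivAt_gaussDeriv k (y - s)).comp y ((hasDerivAt_id y).sub_const s)
    simpa [Function.comp_def] using this.mul_const (h s)

/-- Each derivative is an integral of the same form with k raised by one, so induction over all k
closes. This is the source of smoothness of the profiles `G0` and `G1`. -/
lemma contDiff_integral (hh : GaussIntegrable h μ) (k : ℕ) :
    ContDiff ℝ ∞ (fun η => ∫ s, gaussDeriv k (η - s) * h s ∂μ) := by
  refine contDiff_infty.2 fun n => ?_
  induction n generalizing k with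
  | zero =>
    exact contDiff_zero.2 (continuous_iff_continuousAt.2 fun η =>
      (hh.hasDerivAt_integral k η).continuousAt)
  | succ n ih =>
    push_cast
    refine contDiff_succ_iff_deriv.2
      ⟨fun η => (hh.hasDerivAt_integral k η).differentiableAt, by simp, ?_⟩
    rw [show deriv (fun η => ∫ s, gaussDeriv k (η - s) * h s ∂μ) = _ from
      funext fun η => (hh.hasDerivAt_integral k η).deriv]
    exact ih (k + 1)

/-- Integration by parts against a Gaussian kernel on a half-line. -/
lemma integral_kernel_mul_deriv {a u₀ : ℝ} {u u' : ℝ → ℝ}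
    (hu : ∀ s ∈ Ioi a, HasDerivAt u (u' s) s)
    (hi : GaussIntegrable u (volume.restrict (Ioi a)))
    (hi' : GaussIntegrable u' (volume.restrict (Ioi a)))
    (h0 : Tendsto u (𝓝[>] a) (𝓝 u₀)) (k : ℕ) (η : ℝ) {r : ℝ} (hr : 0 < r) :
    ∫ s in Ioi a, gaussDeriv k (η - s / r) * u' s =
      -(gaussDeriv k (η - a / r) * u₀)
        + r⁻¹ * ∫ s in Ioi a, gaussDeriv (k + 1) (η - s / r) * u s := by
  have hk : ∀ s : ℝ, HasDerivAt (fun s => gaussDeriv k (η - s / r))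
      (-r⁻¹ * gaussDeriv (k + 1) (η - s / r)) s := fun s => by
    have h1 : HasDerivAt (fun s : ℝ => η - s / r) (-r⁻¹) s := by
      simpa using ((hasDerivAt_id s).div_const r).const_sub η
    have := (hasDerivAt_gaussDeriv k (η - s / r)).comp s h1
    rw [mul_comm]; exact this
  have i1 : IntegrableOn ((fun s => gaussDeriv k (η - s / r)) * u') (Ioi a) :=
    hi'.integrable_kernel k η hr
  have i2 : IntegrableOn ((fun s => -r⁻¹ * gaussDeriv (k + 1) (η - s / r)) * u) (Ioi a) := by
    have := (hi.integrable_kernel (k + 1) η hr).const_mul (-r⁻¹)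
    refine this.congr (ae_of_all _ fun s => ?_)
    simp only [Pi.mul_apply]; ring
  have i3 : IntegrableOn ((fun s => gaussDeriv k (η - s / r)) * u) (Ioi a) :=
    hi.integrable_kernel k η hr
  -- No pointwise growth bound on u is available; the product tends to 0 because it and its
  -- derivative are both integrable.
  have hinf : Tendsto ((fun s => gaussDeriv k (η - s / r)) * u) atTop (𝓝 0) :=
    tendsto_zero_of_hasDerivAt_of_integrableOn_Ioi
      (fun s hs => (hk s).mul (hu s hs)) (i2.add i1) i3
  have hzero : Tendsto ((fun s => gaussDeriv k (η - s / r)) * u) (𝓝[>] a)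
      (𝓝 (gaussDeriv k (η - a / r) * u₀)) :=
    ((hk a).continuousAt.tendsto.mono_left nhdsWithin_le_nhds).mul h0
  rw [integral_Ioi_mul_deriv_eq_deriv_mul (fun s _ => hk s) hu i1 i2 hzero hinf]
  simp only [mul_assoc, integral_const_mul]
  ring

end GaussIntegrable

/-- A power times a Gaussian is integrable on the positive half-line. -/
lemma gaussIntegrable_rpow {q : ℝ} (hq : -1 < q) :
    GaussIntegrable (fun s => s ^ q) (volume.restrict (Ioi 0)) := fun _ hc =>
  integrableOn_rpow_mul_exp_neg_mul_sq hc hq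

lemma gaussIntegrable_pow (m : ℕ) :
    GaussIntegrable (fun s => s ^ m) (volume.restrict (Ioi 0)) := by
  have := gaussIntegrable_rpow (q := m) (by have := m.cast_nonneg (α := ℝ); linarith)
  simpa only [Real.rpow_natCast] using this

lemma gaussIntegrable_const (a : ℝ) : GaussIntegrable (fun _ => a) (volume.restrict (Ioi 0)) := by
  simpa using (gaussIntegrable_pow 0).const_mul a

/-- Both halves are log z ≤ z - 1, at z = s and at z = s^{-1/2}. -/
lemma abs_log_le {s : ℝ} (hs : 0 < s) : |Real.log s| ≤ 2 * s ^ (-(1 / 2) : ℝ) + s := by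
  have h1 : Real.log s ≤ s := (Real.log_le_sub_one_of_pos hs).trans (by linarith)
  have h2 : -Real.log s ≤ 2 * s ^ (-(1 / 2) : ℝ) := by
    have h3 := Real.log_le_sub_one_of_pos (Real.rpow_pos_of_pos hs (-(1 / 2)))
    rw [Real.log_rpow hs] at h3
    linarith
  have h4 := Real.rpow_pos_of_pos hs (-(1 / 2))
  exact abs_le.2 ⟨by linarith, by linarith⟩

lemma gaussIntegrable_log : GaussIntegrable Real.log (volume.restrict (Ioi 0)) := by
  refine (((gaussIntegrable_rpow (q := -(1 / 2)) (by norm_num)).const_mul 2).add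
    (gaussIntegrable_pow 1)).mono Real.measurable_log.aestronglyMeasurable ?_
  filter_upwards [ae_restrict_mem measurableSet_Ioi] with s hs
  simpa using abs_log_le hs

/-! ### Functions on the half-line with a decaying power expansion -/

/-- The tail `R(s) - ∑_{l < i} b_l s^{-(l+1)}` of a decaying power expansion. -/
noncomputable def expansionTail (R : ℝ → ℝ) (b : ℕ → ℝ) (i : ℕ) (s : ℝ) : ℝ :=
  R s - ∑ l ∈ Finset.range i, b l / s ^ (l + 1)

/-- `R` is continuous on the positive half-line, is bounded there by a multiple of `s^{-1/2}`, and
has the asymptotic expansion `∑ b_l s^{-(l+1)}` at infinity. -/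
structure PowerTail (R : ℝ → ℝ) (b : ℕ → ℝ) : Prop where
  cont : ContinuousOn R (Ioi 0)
  bound : ∃ C : ℝ, 0 ≤ C ∧ ∀ s : ℝ, 0 < s → |R s| ≤ C * s ^ (-(1 / 2) : ℝ)
  far : ∀ i : ℕ, ∃ C : ℝ, 0 ≤ C ∧ ∀ s : ℝ, 1 ≤ s → |expansionTail R b i s| ≤ C / s ^ (i + 1)

/-- The antiderivative of `R(s) - b₀ / s` that vanishes at infinity. -/
noncomputable def tailPrimitive (R : ℝ → ℝ) (b : ℕ → ℝ) (s : ℝ) : ℝ :=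
  -∫ σ in Ioi s, (R σ - b 0 / σ)

/-- The coefficients of the expansion of `tailPrimitive R b`. -/
noncomputable def primitiveCoeff (b : ℕ → ℝ) (l : ℕ) : ℝ := -b (l + 1) / (l + 1)

lemma integral_Ioi_one_div_pow (l : ℕ) {s : ℝ} (hs : 0 < s) :
    IntegrableOn (fun σ : ℝ => 1 / σ ^ (l + 2)) (Ioi s) ∧
      ∫ σ in Ioi s, 1 / σ ^ (l + 2) = 1 / ((l + 1) * s ^ (l + 1)) := by
  have hl : (-(l + 2) : ℝ) < -1 := by have := l.cast_nonneg (α := ℝ); linarith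
  have he : ∀ n : ℕ, ∀ σ : ℝ, 0 < σ → σ ^ (-(n : ℝ)) = 1 / σ ^ n := fun n σ hσ => by
    rw [Real.rpow_neg hσ.le, Real.rpow_natCast, one_div]
  have e : EqOn (fun σ : ℝ => σ ^ (-(l + 2) : ℝ)) (fun σ => 1 / σ ^ (l + 2)) (Ioi s) :=
    fun σ hσ => by simpa using he (l + 2) σ (hs.trans hσ)
  refine ⟨(integrableOn_Ioi_rpow_of_lt hl hs).congr_fun e measurableSet_Ioi, ?_⟩
  rw [← setIntegral_congr_fun measurableSet_Ioi e, integral_Ioi_rpow_of_lt hl hs]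
  have h1 := he (l + 1) s hs
  rw [show (-(l + 2) + 1 : ℝ) = -((l + 1 : ℕ) : ℝ) by push_cast; ring, h1]
  push_cast
  have : (l : ℝ) + 1 ≠ 0 := by positivity
  field_simp

namespace PowerTail

variable {R : ℝ → ℝ} {b : ℕ → ℝ}

lemma gaussIntegrable (hR : PowerTail R b) : GaussIntegrable R (volume.restrict (Ioi 0)) := by
  obtain ⟨C, -, h⟩ := hR.bound
  refine ((gaussIntegrable_rpow (q := -(1 / 2)) (by norm_num)).const_mul C).mono
    (hR.cont.aestronglyMeasurable measurableSet_Ioi) ?_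
  filter_upwards [ae_restrict_mem measurableSet_Ioi] with s hs using h s hs

lemma continuousOn_expansionTail (hR : PowerTail R b) (i : ℕ) :
    ContinuousOn (expansionTail R b i) (Ioi 0) :=
  hR.cont.sub (continuousOn_finsetSum _ fun l _ => continuousOn_const.div (by fun_prop)
    fun s hs => (pow_pos hs _).ne')

/-- The exponent -3/2 integrates to -1/2, which is what closes `PowerTail` under `tailPrimitive`. On
(0, 1] both s^{-1/2} and 1/s are below s^{-3/2}; beyond 1 the difference is O(s^{-2}). -/
lemma exists_abs_sub_le (hR : PowerTail R b) :
    ∃ C : ℝ, 0 ≤ C ∧ ∀ s : ℝ, 0 < s → |R s - b 0 / s| ≤ C * s ^ (-(3 / 2) : ℝ) := by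
  obtain ⟨C, hC, h⟩ := hR.bound
  obtain ⟨D, hD, h'⟩ := hR.far 1
  refine ⟨C + |b 0| + D, by positivity, fun s hs => ?_⟩
  have hp := Real.rpow_pos_of_pos hs (-(3 / 2))
  rcases le_total s 1 with h1 | h1
  · have h2 : s ^ (-(1 / 2) : ℝ) ≤ s ^ (-(3 / 2) : ℝ) :=
      Real.rpow_le_rpow_of_exponent_ge hs h1 (by norm_num)
    have h3 : 1 / s ≤ s ^ (-(3 / 2) : ℝ) := by
      rw [one_div, ← Real.rpow_neg_one]
      exact Real.rpow_le_rpow_of_exponent_ge hs h1 (by norm_num)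
    have h4 : |b 0 / s| ≤ |b 0| * s ^ (-(3 / 2) : ℝ) := by
      rw [abs_div, abs_of_pos hs, div_eq_mul_one_div]
      gcongr
    have h5 := h s hs
    have h6 := mul_le_mul_of_nonneg_left h2 hC
    have h7 := abs_sub (R s) (b 0 / s)
    nlinarith [mul_nonneg hD hp.le]
  · have h2 : 1 / s ^ 2 ≤ s ^ (-(3 / 2) : ℝ) := by
      rw [one_div, ← Real.rpow_natCast, ← Real.rpow_neg hs.le]
      exact Real.rpow_le_rpow_of_exponent_le h1 (by norm_num)
    have h3 := h' s h1
    simp only [expansionTail, Finset.range_one, Finset.sum_singleton, zero_add, pow_one] at h3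
    rw [div_eq_mul_one_div D] at h3
    have h6 := mul_le_mul_of_nonneg_left h2 hD
    simp only [one_add_one_eq_two] at h3
    nlinarith [mul_nonneg hC hp.le, mul_nonneg (abs_nonneg (b 0)) hp.le]

lemma continuousOn_sub (hR : PowerTail R b) : ContinuousOn (fun s => R s - b 0 / s) (Ioi 0) :=
  hR.cont.sub (continuousOn_const.div continuousOn_id fun _ hs => ne_of_gt hs)

lemma integrableOn_sub (hR : PowerTail R b) {s : ℝ} (hs : 0 < s) :
    IntegrableOn (fun σ => R σ - b 0 / σ) (Ioi s) := by
  obtain ⟨C, -, h⟩ := hR.exists_abs_sub_le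
  refine ((integrableOn_Ioi_rpow_of_lt (a := -(3 / 2)) (by norm_num) hs).const_mul C).mono'
    ((hR.continuousOn_sub.mono (Ioi_subset_Ioi hs.le)).aestronglyMeasurable measurableSet_Ioi) ?_
  filter_upwards [ae_restrict_mem measurableSet_Ioi] with σ hσ using h σ (hs.trans hσ)

lemma hasDerivAt_tailPrimitive (hR : PowerTail R b) {s : ℝ} (hs : 0 < s) :
    HasDerivAt (tailPrimitive R b) (R s - b 0 / s) s := by
  have hs2 : 0 < s / 2 := by positivity
  have hsub : ∀ c, 0 < c → uIcc (s / 2) c ⊆ Ioi 0 := fun c hc =>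
    (convex_Ioi (0 : ℝ)).ordConnected.uIcc_subset hs2 hc
  have hd : HasDerivAt (fun τ => ∫ σ in (s / 2)..τ, (R σ - b 0 / σ)) (R s - b 0 / s) s :=
    intervalIntegral.integral_hasDerivAt_right
      ((hR.continuousOn_sub.mono (hsub s hs)).intervalIntegrable)
      (hR.continuousOn_sub.stronglyMeasurableAtFilter isOpen_Ioi s hs)
      (hR.continuousOn_sub.continuousAt (Ioi_mem_nhds hs))
  refine (hd.sub_const (∫ σ in Ioi (s / 2), (R σ - b 0 / σ))).congr_of_eventuallyEq ?_
  filter_upwards [Ioi_mem_nhds hs] with τ hτ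
  rw [tailPrimitive, ← intervalIntegral.integral_interval_add_Ioi (hR.integrableOn_sub hs2)
    (hR.integrableOn_sub hτ)]
  ring

/-- Termwise integration from s to infinity. The order drops by one because the 1/σ term has already
been removed in `tailPrimitive`. -/
lemma expansionTail_tailPrimitive (hR : PowerTail R b) (i : ℕ) {s : ℝ} (hs : 0 < s) :
    expansionTail (tailPrimitive R b) (primitiveCoeff b) i s =
      -∫ σ in Ioi s, expansionTail R b (i + 1) σ := by
  have h1 : ∀ σ, expansionTail R b (i + 1) σ = (R σ - b 0 / σ)
      - ∑ l ∈ Finset.range i, b (l + 1) * (1 / σ ^ (l + 2)) := fun σ => by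
    rw [expansionTail, Finset.sum_range_succ']
    simp only [div_eq_mul_one_div (b (_ + 1)), zero_add, pow_one, add_assoc, one_add_one_eq_two]
    ring
  simp only [h1]
  rw [integral_sub (hR.integrableOn_sub hs) (integrable_finsetSum _ fun l _ =>
    ((integral_Ioi_one_div_pow l hs).1.const_mul _)), integral_finsetSum _ fun l _ =>
    ((integral_Ioi_one_div_pow l hs).1.const_mul _)]
  simp only [integral_const_mul, (integral_Ioi_one_div_pow _ hs).2]
  rw [expansionTail, tailPrimitive, neg_sub, sub_eq_add_neg, add_comm, ← Finset.sum_neg_distrib]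
  rw [sub_eq_add_neg]
  congr 1
  refine Finset.sum_congr rfl fun l _ => ?_
  rw [primitiveCoeff]
  have : (l : ℝ) + 1 ≠ 0 := by positivity
  field_simp

/-- Lets the integrations by parts be undone near the diagonal, gaining one order of decay for each
derivative. -/
lemma hasDerivAt_expansionTail (hR : PowerTail R b) (i : ℕ) {s : ℝ} (hs : 0 < s) :
    HasDerivAt (expansionTail (tailPrimitive R b) (primitiveCoeff b) i)
      (expansionTail R b (i + 1) s) s := by
  have h : ∀ l : ℕ, HasDerivAt (fun s : ℝ => primitiveCoeff b l / s ^ (l + 1))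
      (b (l + 1) / s ^ (l + 2)) s := fun l => by
    have := ((hasDerivAt_pow (l + 1) s).inv (pow_pos hs _).ne').const_mul (primitiveCoeff b l)
    simp only [div_eq_mul_inv]
    refine this.congr_deriv ?_
    rw [primitiveCoeff]
    have : (l : ℝ) + 1 ≠ 0 := by positivity
    push_cast
    field_simp
    ring
  have h2 := (hR.hasDerivAt_tailPrimitive hs).sub
    (HasDerivAt.fun_sum (u := Finset.range i) fun l _ => h l)
  refine h2.congr_deriv ?_
  rw [expansionTail, Finset.sum_range_succ']
  simp only [zero_add, pow_one, add_assoc, one_add_one_eq_two]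
  ring

/-- The class of functions with a decaying power expansion is stable under `tailPrimitive`. -/
protected lemma tailPrimitive (hR : PowerTail R b) :
    PowerTail (tailPrimitive R b) (primitiveCoeff b) where
  cont := fun s hs => (hR.hasDerivAt_tailPrimitive hs).continuousAt.continuousWithinAt
  bound := by
    obtain ⟨C, hC, h⟩ := hR.exists_abs_sub_le
    refine ⟨2 * C, by positivity, fun s hs => ?_⟩
    have h1 : |tailPrimitive R b s| ≤ ∫ σ in Ioi s, C * σ ^ (-(3 / 2) : ℝ) := by
      rw [tailPrimitive, abs_neg, ← Real.norm_eq_abs]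
      refine norm_integral_le_of_norm_le
        ((integrableOn_Ioi_rpow_of_lt (a := -(3 / 2)) (by norm_num) hs).const_mul C) ?_
      filter_upwards [ae_restrict_mem measurableSet_Ioi] with σ hσ using h σ (hs.trans hσ)
    rw [integral_const_mul, integral_Ioi_rpow_of_lt (by norm_num) hs] at h1
    norm_num at h1 ⊢
    linarith
  far := fun i => by
    obtain ⟨C, hC, h⟩ := hR.far (i + 1)
    refine ⟨C, hC, fun s hs => ?_⟩
    have hs0 : 0 < s := by linarith
    rw [hR.expansionTail_tailPrimitive i hs0, abs_neg]
    have h1 : |∫ σ in Ioi s, expansionTail R b (i + 1) σ|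
        ≤ ∫ σ in Ioi s, C * (1 / σ ^ (i + 2)) := by
      rw [← Real.norm_eq_abs]
      refine norm_integral_le_of_norm_le ((integral_Ioi_one_div_pow i hs0).1.const_mul C) ?_
      filter_upwards [ae_restrict_mem measurableSet_Ioi] with σ hσ
      rw [← div_eq_mul_one_div]
      exact h σ (hs.trans (le_of_lt hσ))
    rw [integral_const_mul, (integral_Ioi_one_div_pow i hs0).2] at h1
    refine h1.trans ?_
    rw [← div_eq_mul_one_div]
    have h2 : 1 ≤ (i : ℝ) + 1 := by have := i.cast_nonneg (α := ℝ); linarith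
    have h3 := pow_pos hs0 (i + 1)
    gcongr
    nlinarith

/-- The antiderivative of `R` vanishing at the origin, up to a logarithm and a constant. -/
lemma exists_primitive (hR : PowerTail R b) :
    ∃ γ : ℝ, Tendsto (fun s => tailPrimitive R b s + (b 0 * Real.log s + γ)) (𝓝[>] 0) (𝓝 0) := by
  have hii : IntegrableOn R (Ioc 0 1) := by
    obtain ⟨C, -, h⟩ := hR.bound
    have h1 : IntegrableOn (fun s : ℝ => C * s ^ (-(1 / 2) : ℝ)) (Ioc 0 1) := by
      have := (intervalIntegral.intervalIntegrable_rpow' (a := 0) (b := 1)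
        (r := -(1 / 2)) (by norm_num)).const_mul C
      exact (intervalIntegrable_iff_integrableOn_Ioc_of_le zero_le_one).1 this
    refine h1.mono' ((hR.cont.mono fun s hs => hs.1).aestronglyMeasurable measurableSet_Ioc) ?_
    filter_upwards [ae_restrict_mem measurableSet_Ioc] with s hs using h s hs.1
  have hint : ∀ s, 0 < s → IntervalIntegrable R volume 0 s := fun s hs => by
    refine ((intervalIntegrable_iff_integrableOn_Ioc_of_le zero_le_one).2 hii).trans ?_
    exact (hR.cont.mono ((convex_Ioi (0 : ℝ)).ordConnected.uIcc_subset
      (mem_Ioi.2 one_pos) hs)).intervalIntegrable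
  set H : ℝ → ℝ := fun s => ∫ σ in (0 : ℝ)..s, R σ with hH
  have hHd : ∀ s, 0 < s → HasDerivAt H (R s) s := fun s hs =>
    intervalIntegral.integral_hasDerivAt_right (hint s hs)
      (hR.cont.stronglyMeasurableAtFilter isOpen_Ioi s hs)
      (hR.cont.continuousAt (Ioi_mem_nhds hs))
  have hH0 : Tendsto H (𝓝[>] 0) (𝓝 0) := by
    have hc : ContinuousOn H (Icc 0 1) :=
      intervalIntegral.continuousOn_primitive_interval' (hint 1 one_pos)
        (left_mem_uIcc) |>.mono (by rw [uIcc_of_le zero_le_one])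
    have h1 : Tendsto H (𝓝[Icc 0 1] 0) (𝓝 (H 0)) := hc 0 (by simp)
    have h2 : H 0 = 0 := by simp [hH]
    rw [h2] at h1
    refine h1.mono_left ?_
    rw [nhdsWithin_le_iff]
    filter_upwards [Ioo_mem_nhdsGT one_pos] with s hs using ⟨hs.1.le, hs.2.le⟩
  -- The primitive from 0 and the one from infinity, corrected by b₀ log s, have equal derivatives,
  -- so they differ by a constant; γ is its value at 1.
  have hDd : ∀ s, 0 < s → HasDerivAt
      (fun s => H s - tailPrimitive R b s - b 0 * Real.log s) 0 s := fun s hs => by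
    refine (((hHd s hs).sub (hR.hasDerivAt_tailPrimitive hs)).sub
      ((Real.hasDerivAt_log hs.ne').const_mul (b 0))).congr_deriv ?_
    rw [div_eq_mul_inv]; ring
  refine ⟨H 1 - tailPrimitive R b 1, hH0.congr' ?_⟩
  filter_upwards [self_mem_nhdsWithin] with s hs
  have := isOpen_Ioi.is_const_of_deriv_eq_zero isPreconnected_Ioi
    (fun s hs => (hDd s hs).differentiableAt.differentiableWithinAt)
    (fun s hs => (hDd s hs).deriv) (show s ∈ Ioi (0 : ℝ) from hs)
    (mem_Ioi.2 one_pos)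
  simp only [Real.log_one] at this
  linarith

end PowerTail

/-! ### The exact expansion with remainder -/

/-- The `n`-th `x`-derivative of the Gaussian convolution of `R` restricted to the positive
half-line, at `x = r η`. -/
noncomputable def scaledIntegral (n : ℕ) (R : ℝ → ℝ) (η r : ℝ) : ℝ :=
  (r ^ (n + 1))⁻¹ * ∫ s in Ioi 0, gaussDeriv n (η - s / r) * R s

/-- The Gaussian convolution of the Heaviside function, differentiated `k` times. -/
noncomputable def stepProfile (k : ℕ) (η : ℝ) : ℝ :=
  ∫ s in Ioi 0, gaussDeriv k (η - s) * 1

/-- The Gaussian convolution of the logarithm on the half-line, differentiated `k` times. -/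
noncomputable def logProfile (k : ℕ) (η : ℝ) : ℝ :=
  ∫ s in Ioi 0, gaussDeriv k (η - s) * Real.log s

lemma contDiff_stepProfile (k : ℕ) : ContDiff ℝ ∞ (stepProfile k) :=
  (gaussIntegrable_const 1).contDiff_integral k

lemma contDiff_logProfile (k : ℕ) : ContDiff ℝ ∞ (logProfile k) :=
  gaussIntegrable_log.contDiff_integral k

lemma integral_Ioi_kernel_scale (k : ℕ) (f : ℝ → ℝ) (η : ℝ) {r : ℝ} (hr : 0 < r) :
    ∫ s in Ioi 0, gaussDeriv k (η - s / r) * f s =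
      r * ∫ s in Ioi 0, gaussDeriv k (η - s) * f (r * s) := by
  have h := integral_comp_mul_left_Ioi (fun s => gaussDeriv k (η - s / r) * f s) 0 hr
  simp only [mul_zero, smul_eq_mul, mul_div_cancel_left₀ _ hr.ne'] at h
  rw [h, mul_inv_cancel_left₀ hr.ne']

/-- Substituting s = rσ splits log s into log r + log σ; this is where the logarithm of t enters the
expansion. -/
lemma integral_kernel_log (k : ℕ) (β γ η : ℝ) {r : ℝ} (hr : 0 < r) :
    ∫ s in Ioi 0, gaussDeriv k (η - s / r) * (β * Real.log s + γ) =
      r * (β * logProfile k η + γ * stepProfile k η + β * stepProfile k η * Real.log r) := by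
  rw [integral_Ioi_kernel_scale k _ η hr]
  have h1 : ∫ s in Ioi 0, gaussDeriv k (η - s) * (β * Real.log (r * s) + γ) =
      ∫ s in Ioi 0, (β * (gaussDeriv k (η - s) * Real.log s)
        + (γ + β * Real.log r) * (gaussDeriv k (η - s) * 1)) := by
    refine setIntegral_congr_fun measurableSet_Ioi fun s hs => ?_
    simp only [Real.log_mul hr.ne' (ne_of_gt hs)]
    ring
  have i1 := gaussIntegrable_log.integrable_kernel k η one_pos
  have i2 := (gaussIntegrable_const 1).integrable_kernel k η one_pos
  simp only [div_one] at i1 i2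
  rw [h1, integral_add (i1.const_mul _) (i2.const_mul _), integral_const_mul, integral_const_mul]
  simp only [logProfile, stepProfile]
  ring

/-- One integration by parts. The antiderivative of R is normalised to vanish at 0, so there is no
boundary term, and γ does not depend on n, η or r. -/
lemma PowerTail.exists_scaledIntegral_eq {R : ℝ → ℝ} {b : ℕ → ℝ} (hR : PowerTail R b) :
    ∃ γ : ℝ, ∀ (n : ℕ) (η r : ℝ), 0 < r → scaledIntegral n R η r =
      scaledIntegral (n + 1) (tailPrimitive R b) η r + (r ^ (n + 1))⁻¹ *
        (b 0 * logProfile (n + 1) η + γ * stepProfile (n + 1) η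
          + b 0 * stepProfile (n + 1) η * Real.log r) := by
  obtain ⟨γ, hγ⟩ := hR.exists_primitive
  refine ⟨γ, fun n η r hr => ?_⟩
  have g1 := hR.tailPrimitive.gaussIntegrable
  have g2 : GaussIntegrable (fun s => b 0 * Real.log s + γ) (volume.restrict (Ioi 0)) :=
    (gaussIntegrable_log.const_mul (b 0)).add (gaussIntegrable_const γ)
  have hd : ∀ s ∈ Ioi (0 : ℝ), HasDerivAt
      (fun s => tailPrimitive R b s + (b 0 * Real.log s + γ)) (R s) s := fun s hs => by
    refine ((hR.hasDerivAt_tailPrimitive hs).add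
      (((Real.hasDerivAt_log (ne_of_gt hs)).const_mul (b 0)).add_const γ)).congr_deriv ?_
    rw [div_eq_mul_inv]; ring
  rw [scaledIntegral, GaussIntegrable.integral_kernel_mul_deriv hd (g1.add g2)
    hR.gaussIntegrable hγ n η hr]
  simp only [mul_add (gaussDeriv (n + 1) _) (tailPrimitive R b _)]
  rw [integral_add (g1.integrable_kernel (n + 1) η hr) (g2.integrable_kernel (n + 1) η hr),
    integral_kernel_log (n + 1) _ _ η hr, scaledIntegral, pow_succ r (n + 1)]
  field_simp
  ring

/-- The coefficients of the iterated antiderivatives of a `PowerTail`. -/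
noncomputable def coeffIter (b : ℕ → ℝ) : ℕ → ℕ → ℝ
  | 0 => b
  | n + 1 => primitiveCoeff (coeffIter b n)

/-- The iterated antiderivatives of a `PowerTail`. -/
noncomputable def tailIter (R : ℝ → ℝ) (b : ℕ → ℝ) : ℕ → ℝ → ℝ
  | 0 => R
  | n + 1 => tailPrimitive (tailIter R b n) (coeffIter b n)

namespace PowerTail

variable {R : ℝ → ℝ} {b : ℕ → ℝ}

lemma iter (hR : PowerTail R b) (n : ℕ) : PowerTail (tailIter R b n) (coeffIter b n) := by
  induction n with
  | zero => exact hR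
  | succ n ih => exact ih.tailPrimitive

lemma exists_expansion (hR : PowerTail R b) :
    ∃ G0 G1 : ℕ → ℝ → ℝ, (∀ n, ContDiff ℝ ∞ (G0 n) ∧ ContDiff ℝ ∞ (G1 n)) ∧
      ∀ (N : ℕ) (η r : ℝ), 0 < r → scaledIntegral 0 R η r =
        ∑ n ∈ Finset.Icc 1 N, (r ^ n)⁻¹ * (G0 n η + G1 n η * Real.log r)
          + scaledIntegral N (tailIter R b N) η r := by
  choose γ hγ using fun n => (hR.iter n).exists_scaledIntegral_eq
  -- The n-th term arises from integrating the (n-1)-th tail; the value at n = 0 is never summed.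
  refine ⟨fun n η => coeffIter b (n - 1) 0 * logProfile n η + γ (n - 1) * stepProfile n η,
    fun n η => coeffIter b (n - 1) 0 * stepProfile n η, fun n => ⟨?_, ?_⟩, fun N η r hr => ?_⟩
  · exact (contDiff_const.mul (contDiff_logProfile n)).add
      (contDiff_const.mul (contDiff_stepProfile n))
  · exact contDiff_const.mul (contDiff_stepProfile n)
  · induction N with
    | zero => simp [tailIter]
    | succ N ih =>
      rw [Finset.sum_Icc_succ_top (by omega), ih, hγ N N η r hr]
      simp only [add_tsub_cancel_right, tailIter]
      ring

end PowerTail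

/-! ### The remainder estimate -/

/-- After scaling out r, uniformity in η comes from splitting at s = 1: below it the kernel is at
most 1 and the singularity is integrable, above it the power is at most 1. -/
lemma exists_integral_kernel_rpow_le : ∃ C : ℝ, 0 ≤ C ∧ ∀ η r : ℝ, 0 < r →
    ∫ s in Ioi 0, gaussDeriv 0 (η - s / r) * s ^ (-(1 / 2) : ℝ) ≤ C * r ^ (1 / 2 : ℝ) := by
  have hI : IntegrableOn (fun s : ℝ => s ^ (-(1 / 2) : ℝ)) (Ioc 0 1) :=
    (intervalIntegrable_iff_integrableOn_Ioc_of_le zero_le_one).1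
      (intervalIntegral.intervalIntegrable_rpow' (by norm_num))
  have hG : ∀ η : ℝ, Integrable (fun s => gaussDeriv 0 (η - s)) ∧
      ∫ s, gaussDeriv 0 (η - s) = √Real.pi := fun η => by
    have h1 : Integrable (gaussDeriv 0) := by
      refine (integrable_exp_neg_mul_sq one_pos).congr (ae_of_all _ fun s => ?_)
      simp [gaussDeriv_zero]
    refine ⟨h1.comp_sub_left η, ?_⟩
    rw [integral_sub_left_eq_self]
    simpa [gaussDeriv_zero] using integral_gaussian 1
  refine ⟨(∫ s in Ioc (0 : ℝ) 1, s ^ (-(1 / 2) : ℝ)) + √Real.pi, ?_, fun η r hr => ?_⟩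
  · exact add_nonneg (setIntegral_nonneg measurableSet_Ioc fun s hs =>
      Real.rpow_nonneg hs.1.le _) (Real.sqrt_nonneg _)
  have h1 : ∫ s in Ioi 0, gaussDeriv 0 (η - s) * s ^ (-(1 / 2) : ℝ) ≤
      ∫ s in Ioi 0, ((Ioc (0 : ℝ) 1).indicator (fun s => s ^ (-(1 / 2) : ℝ)) s
        + gaussDeriv 0 (η - s)) := by
    have i1 := (gaussIntegrable_rpow (q := -(1 / 2)) (by norm_num)).integrable_kernel 0 η one_pos
    simp only [div_one] at i1
    refine setIntegral_mono_on i1 (((integrable_indicator_iff measurableSet_Ioc).2 hI).integrableOn.add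
      (hG η).1.integrableOn) measurableSet_Ioi fun s hs => ?_
    have hp := Real.rpow_pos_of_pos (mem_Ioi.1 hs) (-(1 / 2))
    have hg : 0 < gaussDeriv 0 (η - s) := by rw [gaussDeriv_zero]; positivity
    have hg1 : gaussDeriv 0 (η - s) ≤ 1 := by
      rw [gaussDeriv_zero]; exact Real.exp_le_one_iff.2 (by nlinarith [sq_nonneg (η - s)])
    by_cases h : s ≤ 1
    · rw [indicator_of_mem (show s ∈ Ioc (0 : ℝ) 1 from ⟨hs, h⟩)]
      nlinarith
    · rw [indicator_of_notMem (fun h' => h h'.2)]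
      have : s ^ (-(1 / 2) : ℝ) ≤ 1 :=
        Real.rpow_le_one_of_one_le_of_nonpos (by linarith) (by norm_num)
      nlinarith
  rw [integral_add ((integrable_indicator_iff measurableSet_Ioc).2 hI).integrableOn
    (hG η).1.integrableOn, setIntegral_indicator measurableSet_Ioc,
    inter_eq_right.2 Ioc_subset_Ioi_self] at h1
  have h2 : ∫ s in Ioi 0, gaussDeriv 0 (η - s) ≤ √Real.pi := by
    rw [← (hG η).2]
    refine setIntegral_le_integral (hG η).1 (ae_of_all _ fun s => ?_)
    simp only [gaussDeriv_zero]; exact (Real.exp_pos _).le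
  rw [integral_Ioi_kernel_scale 0 _ η hr]
  have h3 : ∫ s in Ioi 0, gaussDeriv 0 (η - s) * (r * s) ^ (-(1 / 2) : ℝ) =
      r ^ (-(1 / 2) : ℝ) * ∫ s in Ioi 0, gaussDeriv 0 (η - s) * s ^ (-(1 / 2) : ℝ) := by
    rw [← integral_const_mul]
    refine setIntegral_congr_fun measurableSet_Ioi fun s hs => ?_
    simp only [Real.mul_rpow hr.le (le_of_lt hs)]
    ring
  have h4 : r * r ^ (-(1 / 2) : ℝ) = r ^ (1 / 2 : ℝ) := by
    rw [← Real.rpow_one_add' hr.le (by norm_num)]; norm_num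
  rw [h3, ← mul_assoc, h4, mul_comm]
  gcongr
  linarith

/-- Away from the diagonal the Gaussian kernel is small. -/
lemma PowerTail.exists_abs_integral_far_le {R : ℝ → ℝ} {b : ℕ → ℝ} (hR : PowerTail R b) (n : ℕ) :
    ∃ C : ℝ, 0 ≤ C ∧ ∀ (η r : ℝ) (A : Set ℝ), 0 < r → MeasurableSet A → A ⊆ Ioi 0 →
      (∀ s ∈ A, η ^ 2 / 4 - 1 ≤ (η - s / r) ^ 2) →
      |∫ s in A, gaussDeriv n (η - s / r) * R s| ≤
        C * Real.exp (-(1 / 16) * η ^ 2) * r ^ (1 / 2 : ℝ) := by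
  obtain ⟨C, hC, h1⟩ := exists_abs_gaussDeriv_le n
  obtain ⟨D, hD, h2⟩ := hR.bound
  obtain ⟨E, hE, h3⟩ := exists_integral_kernel_rpow_le
  refine ⟨C * D * Real.exp (1 / 4) * (E * 2 ^ (1 / 2 : ℝ)), by positivity,
    fun η r A hr hA hA0 hfar => ?_⟩
  have hi : IntegrableOn (fun s => gaussDeriv 0 (η / 2 - s / (2 * r)) * s ^ (-(1 / 2) : ℝ))
      (Ioi 0) := (gaussIntegrable_rpow (by norm_num)).integrable_kernel 0 _ (by positivity)
  have hle : ∀ s ∈ A, ‖gaussDeriv n (η - s / r) * R s‖ ≤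
      C * D * (Real.exp (1 / 4) * Real.exp (-(1 / 16) * η ^ 2)) *
        (gaussDeriv 0 (η / 2 - s / (2 * r)) * s ^ (-(1 / 2) : ℝ)) := fun s hs => by
    have hp := Real.rpow_pos_of_pos (hA0 hs) (-(1 / 2))
    rw [norm_mul, Real.norm_eq_abs, Real.norm_eq_abs, gaussDeriv_zero]
    calc |gaussDeriv n (η - s / r)| * |R s|
        ≤ (C * Real.exp (-(1 / 2) * (η - s / r) ^ 2)) * (D * s ^ (-(1 / 2) : ℝ)) :=
          mul_le_mul (h1 _) (h2 s (hA0 hs)) (abs_nonneg _) (by positivity)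
      -- Half of the exponent is spent on `hfar`, giving decay in η; the other half is a Gaussian of
      -- width 2r kept for integrating the power.
      _ ≤ (C * (Real.exp (1 / 4) * Real.exp (-(1 / 16) * η ^ 2) *
            Real.exp (-(η / 2 - s / (2 * r)) ^ 2))) * (D * s ^ (-(1 / 2) : ℝ)) := by
          gcongr
          rw [← Real.exp_add, ← Real.exp_add]
          gcongr
          have := hfar s hs
          have e : (η / 2 - s / (2 * r)) ^ 2 = (η - s / r) ^ 2 / 4 := by field_simp; ring
          rw [e]
          linarith
      _ = _ := by ring
  have h5 := norm_integral_le_of_norm_le (μ := volume.restrict A)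
    ((hi.mono_set hA0).const_mul _) ((ae_restrict_mem hA).mono hle)
  rw [integral_const_mul, Real.norm_eq_abs] at h5
  refine h5.trans ?_
  have h6 : ∫ s in A, gaussDeriv 0 (η / 2 - s / (2 * r)) * s ^ (-(1 / 2) : ℝ) ≤
      E * (2 * r) ^ (1 / 2 : ℝ) := by
    refine (setIntegral_mono_set hi ?_ hA0.eventuallyLE).trans (h3 _ _ (by positivity))
    filter_upwards [ae_restrict_mem measurableSet_Ioi] with s hs
    rw [gaussDeriv_zero]
    exact mul_nonneg (Real.exp_pos _).le (Real.rpow_nonneg (le_of_lt hs) _)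
  rw [Real.mul_rpow zero_le_two hr.le] at h6
  calc _ ≤ C * D * (Real.exp (1 / 4) * Real.exp (-(1 / 16) * η ^ 2)) *
        (E * (2 ^ (1 / 2 : ℝ) * r ^ (1 / 2 : ℝ))) := by gcongr
    _ = _ := by ring

namespace PowerTail

variable {R : ℝ → ℝ} {b : ℕ → ℝ}

lemma gaussIntegrable_expansionTail (hR : PowerTail R b) (i : ℕ) {a : ℝ} (ha : 1 ≤ a) :
    GaussIntegrable (expansionTail R b i) (volume.restrict (Ioi a)) := by
  obtain ⟨C, hC, h⟩ := hR.far i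
  have hsub : Ioi a ⊆ Ioi (0 : ℝ) := Ioi_subset_Ioi (by linarith)
  refine ((gaussIntegrable_const C).mono_measure (Measure.restrict_mono hsub le_rfl)).mono
    (((hR.continuousOn_expansionTail i).mono hsub).aestronglyMeasurable measurableSet_Ioi) ?_
  filter_upwards [ae_restrict_mem measurableSet_Ioi] with s hs
  have hs1 : 1 ≤ s := ha.trans (le_of_lt hs)
  exact (h s hs1).trans (div_le_self hC (one_le_pow₀ hs1))

/-- Near the diagonal, repeated integration by parts moves all derivatives to the other factor. -/
lemma exists_abs_integral_near_le (hR : PowerTail R b) (j i : ℕ) :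
    ∃ C : ℝ, 0 ≤ C ∧ ∀ η r : ℝ, 1 ≤ η → 0 < r → 2 ≤ r * η →
      |(r ^ (j + 1))⁻¹ * ∫ s in Ioi (r * η / 2), gaussDeriv j (η - s / r) *
        expansionTail (tailIter R b j) (coeffIter b j) i s| ≤ C / (r * η) ^ (i + j + 1) := by
  induction j generalizing i with
  | zero =>
    obtain ⟨C, hC, h⟩ := hR.far i
    refine ⟨C * 2 ^ (i + 1) * √Real.pi, by positivity, fun η r hη hr hx => ?_⟩
    have hG : Integrable (fun s => gaussDeriv 0 (η - s / r)) ∧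
        ∫ s, gaussDeriv 0 (η - s / r) = r * √Real.pi := by
      have h1 : Integrable (gaussDeriv 0) := by
        refine (integrable_exp_neg_mul_sq one_pos).congr (ae_of_all _ fun s => ?_)
        simp [gaussDeriv_zero]
      refine ⟨(h1.comp_sub_left η).comp_div hr.ne', ?_⟩
      rw [Measure.integral_comp_div (fun s => gaussDeriv 0 (η - s)), integral_sub_left_eq_self,
        abs_of_pos hr, smul_eq_mul]
      congr 1
      simpa [gaussDeriv_zero] using integral_gaussian 1
    have hpos : ∀ s, 0 ≤ gaussDeriv 0 (η - s / r) := fun s => by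
      rw [gaussDeriv_zero]; exact (Real.exp_pos _).le
    have h2 : ‖∫ s in Ioi (r * η / 2), gaussDeriv 0 (η - s / r) * expansionTail R b i s‖ ≤
        ∫ s in Ioi (r * η / 2), gaussDeriv 0 (η - s / r) * (C / (r * η / 2) ^ (i + 1)) := by
      refine norm_integral_le_of_norm_le (hG.1.integrableOn.mul_const _) ?_
      filter_upwards [ae_restrict_mem measurableSet_Ioi] with s hs
      have hs' : r * η / 2 ≤ s := le_of_lt hs
      rw [norm_mul, Real.norm_eq_abs, Real.norm_eq_abs, abs_of_nonneg (hpos s)]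
      refine mul_le_mul_of_nonneg_left ((h s (by linarith)).trans ?_) (hpos s)
      gcongr
    rw [integral_mul_const, Real.norm_eq_abs] at h2
    have h3 : ∫ s in Ioi (r * η / 2), gaussDeriv 0 (η - s / r) ≤ r * √Real.pi :=
      hG.2 ▸ setIntegral_le_integral hG.1 (ae_of_all _ hpos)
    rw [abs_mul, abs_of_pos (inv_pos.2 (pow_pos hr _))]
    simp only [tailIter, coeffIter, zero_add, pow_one, add_zero]
    calc _ ≤ r⁻¹ * ((r * √Real.pi) * (C / (r * η / 2) ^ (i + 1))) := by
          gcongr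
          refine h2.trans ?_
          gcongr
      _ = _ := by rw [div_pow]; field_simp
  | succ j ih =>
    obtain ⟨C, hC, h⟩ := ih (i + 1)
    obtain ⟨D, hD, hk⟩ := exists_abs_gaussDeriv_le j
    -- The rate 1/8 exactly cancels exp(-(η/2)²/2) from the boundary term at s = rη/2.
    obtain ⟨E, hE, he⟩ := exists_abs_pow_le_exp_sq (j + 1) (c := 1 / 8) (by norm_num)
    obtain ⟨F, hF, hf⟩ := (hR.iter (j + 1)).far i
    refine ⟨C + D * E * (F * 2 ^ (i + 1)), by positivity, fun η r hη hr hx => ?_⟩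
    have ha : 1 ≤ r * η / 2 := by linarith
    have ha0 : 0 < r * η / 2 := by linarith
    have hη0 : 0 < η := by linarith
    have hibp := GaussIntegrable.integral_kernel_mul_deriv
      (fun s hs => (hR.iter j).hasDerivAt_expansionTail i (ha0.trans (mem_Ioi.1 hs)))
      ((hR.iter (j + 1)).gaussIntegrable_expansionTail i ha)
      ((hR.iter j).gaussIntegrable_expansionTail (i + 1) ha)
      ((((hR.iter (j + 1)).continuousOn_expansionTail i).continuousAt
        (Ioi_mem_nhds ha0)).tendsto.mono_left nhdsWithin_le_nhds) j η hr
    rw [show η - r * η / 2 / r = η / 2 by field_simp; ring] at hibp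
    have h1 := h η r hη hr hx
    rw [hibp] at h1
    set I := ∫ s in Ioi (r * η / 2), gaussDeriv (j + 1) (η - s / r) *
      expansionTail (tailIter R b (j + 1)) (coeffIter b (j + 1)) i s with hI
    set u := expansionTail (tailIter R b (j + 1)) (coeffIter b (j + 1)) i (r * η / 2) with hu
    -- Integration by parts is read backwards: the integral with j + 1 derivatives equals the one
    -- with j, bounded by induction at order i + 1, plus the boundary term.
    have h2 : (r ^ (j + 1 + 1))⁻¹ * I =
        (r ^ (j + 1))⁻¹ * (-(gaussDeriv j (η / 2) * u) + r⁻¹ * I)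
          + (r ^ (j + 1))⁻¹ * gaussDeriv j (η / 2) * u := by
      rw [pow_succ r (j + 1), mul_inv]; ring
    rw [h2]
    have h3 : |(r ^ (j + 1))⁻¹ * gaussDeriv j (η / 2)| ≤ D * E / (r * η) ^ (j + 1) := by
      rw [abs_mul, abs_of_pos (inv_pos.2 (pow_pos hr _)), mul_pow, le_div_iff₀ (by positivity)]
      have h4 := hk (η / 2)
      have h5 := he η
      rw [abs_of_pos hη0] at h5
      calc _ = |gaussDeriv j (η / 2)| * η ^ (j + 1) := by field_simp
        _ ≤ (D * Real.exp (-(1 / 2) * (η / 2) ^ 2)) * (E * Real.exp (1 / 8 * η ^ 2)) := by gcongr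
        _ = D * E * (Real.exp (-(1 / 2) * (η / 2) ^ 2) * Real.exp (1 / 8 * η ^ 2)) := by ring
        _ = _ := by
          rw [← Real.exp_add, show -(1 / 2) * (η / 2) ^ 2 + 1 / 8 * η ^ 2 = 0 by ring,
            Real.exp_zero, mul_one]
    have h6 : |u| ≤ F * 2 ^ (i + 1) / (r * η) ^ (i + 1) := by
      refine (hf _ ha).trans (le_of_eq ?_)
      rw [div_pow]; field_simp
    calc _ ≤ C / (r * η) ^ (i + 1 + j + 1)
          + D * E / (r * η) ^ (j + 1) * (F * 2 ^ (i + 1) / (r * η) ^ (i + 1)) := by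
          refine (abs_add_le _ _).trans (add_le_add h1 ?_)
          rw [abs_mul]
          exact mul_le_mul h3 h6 (abs_nonneg _) (by positivity)
      _ = _ := by
          rw [div_mul_div_comm, ← pow_add, show j + 1 + (i + 1) = i + (j + 1) + 1 by ring,
            show i + 1 + j + 1 = i + (j + 1) + 1 by ring, ← add_div]

/-- Uniform remainder estimate. -/
lemma exists_abs_remainder_le (hR : PowerTail R b) (N : ℕ) :
    ∃ C : ℝ, ∀ η r : ℝ, 0 < r → (η ≤ 1 ∨ 2 ≤ r * η) →
      |scaledIntegral N (tailIter R b N) η r| ≤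
        C * (r ^ 2 * (1 + η ^ 2)) ^ (-((N : ℝ) / 2 + 1 / 4)) := by
  obtain ⟨C, hC, h⟩ := (hR.iter N).exists_abs_integral_far_le N
  obtain ⟨D, hD, h'⟩ := hR.exists_abs_integral_near_le N 0
  obtain ⟨E, hE, he⟩ := exists_abs_eval_le_exp_sq ((1 + Polynomial.X ^ 2) ^ (N + 1))
    (c := 1 / 16) (by norm_num)
  -- Chosen so that r^{-(N+1)} · r^{1/2} = (r²)^{-q}.
  set q : ℝ := (N : ℝ) / 2 + 1 / 4 with hq
  have hq0 : 0 < q := by positivity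
  have hfar : ∀ (η r : ℝ) (A : Set ℝ), 0 < r → MeasurableSet A → A ⊆ Ioi 0 →
      (∀ s ∈ A, η ^ 2 / 4 - 1 ≤ (η - s / r) ^ 2) →
      |(r ^ (N + 1))⁻¹ * ∫ s in A, gaussDeriv N (η - s / r) * tailIter R b N s| ≤
        C * E * (r ^ 2 * (1 + η ^ 2)) ^ (-q) := fun η r A hr hA hA0 hf => by
    have h1 := h η r A hr hA hA0 hf
    have h2 := he η
    have h3 : 1 ≤ 1 + η ^ 2 := by nlinarith [sq_nonneg η]
    have h4 : (1 + η ^ 2) ^ q ≤ E * Real.exp (1 / 16 * η ^ 2) := by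
      refine le_trans ?_ ((le_abs_self _).trans h2)
      simp only [Polynomial.eval_pow, Polynomial.eval_add, Polynomial.eval_one, Polynomial.eval_X]
      rw [← Real.rpow_natCast _ (N + 1)]
      refine Real.rpow_le_rpow_of_exponent_le h3 ?_
      have := N.cast_nonneg (α := ℝ)
      push_cast
      rw [hq]; linarith
    have h5 : Real.exp (-(1 / 16) * η ^ 2) ≤ E * (1 + η ^ 2) ^ (-q) := by
      rw [Real.rpow_neg (by linarith), ← div_eq_mul_inv, le_div_iff₀ (by positivity)]
      calc _ ≤ Real.exp (-(1 / 16) * η ^ 2) * (E * Real.exp (1 / 16 * η ^ 2)) := by gcongr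
        _ = E * (Real.exp (-(1 / 16) * η ^ 2) * Real.exp (1 / 16 * η ^ 2)) := by ring
        _ = _ := by
          rw [← Real.exp_add, show -(1 / 16) * η ^ 2 + 1 / 16 * η ^ 2 = 0 by ring,
            Real.exp_zero, mul_one]
    have h6 : (r ^ (N + 1))⁻¹ * r ^ (1 / 2 : ℝ) = (r ^ 2) ^ (-q) := by
      rw [← Real.rpow_natCast, ← Real.rpow_neg hr.le, ← Real.rpow_add hr, ← Real.rpow_natCast r 2,
        ← Real.rpow_mul hr.le]
      congr 1
      push_cast
      rw [hq]; ring
    rw [abs_mul, abs_of_pos (inv_pos.2 (pow_pos hr _)), Real.mul_rpow (by positivity)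
      (by positivity), ← h6]
    calc _ ≤ (r ^ (N + 1))⁻¹ * (C * Real.exp (-(1 / 16) * η ^ 2) * r ^ (1 / 2 : ℝ)) := by gcongr
      _ ≤ (r ^ (N + 1))⁻¹ * (C * (E * (1 + η ^ 2) ^ (-q)) * r ^ (1 / 2 : ℝ)) := by gcongr
      _ = _ := by ring
  refine ⟨C * E + D * 2 ^ q, fun η r hr hcase => ?_⟩
  have hpos : 0 < (r ^ 2 * (1 + η ^ 2)) ^ (-q) := by positivity
  -- For η ≤ 1 the whole half-line counts as far from the diagonal; otherwise it is cut at s = rη/2,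
  -- half of x.
  rcases le_or_gt η 1 with hη | hη
  · refine (hfar η r (Ioi 0) hr measurableSet_Ioi subset_rfl fun s hs => ?_).trans ?_
    · have hs' : 0 < s / r := div_pos hs hr
      rcases le_total η 0 with h0 | h0
      · nlinarith
      · nlinarith [sq_nonneg (η - s / r)]
    · gcongr
      have : 0 ≤ D * 2 ^ q := by positivity
      linarith
  · have hx : 2 ≤ r * η := hcase.resolve_left (by linarith)
    have h1 := hfar η r (Ioc 0 (r * η / 2)) hr measurableSet_Ioc Ioc_subset_Ioi_self
      fun s hs => by
        have h2 : s / r ≤ η / 2 := by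
          rw [div_le_iff₀ hr]; linarith [hs.2]
        nlinarith
    have h2 := h' η r hη.le hr hx
    have h3 : expansionTail (tailIter R b N) (coeffIter b N) 0 = tailIter R b N := by
      funext s; simp [expansionTail]
    rw [h3, zero_add] at h2
    have h4 : 1 / (r * η) ^ (N + 1) ≤ 2 ^ q * (r ^ 2 * (1 + η ^ 2)) ^ (-q) := by
      have h5 : r ^ 2 * (1 + η ^ 2) ≤ 2 * (r * η) ^ 2 := by
        have h7 : 1 ≤ η ^ 2 := by nlinarith
        rw [mul_pow]; nlinarith [sq_nonneg r]
      have h6 : (r ^ 2 * (1 + η ^ 2)) ^ q ≤ 2 ^ q * (r * η) ^ (N + 1) := by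
        calc _ ≤ (2 * (r * η) ^ 2) ^ q := by gcongr
          _ = 2 ^ q * (r * η) ^ (2 * q) := by
            rw [Real.mul_rpow zero_le_two (by positivity), ← Real.rpow_natCast (r * η) 2,
              ← Real.rpow_mul (by positivity)]
            norm_num
          _ ≤ _ := by
            rw [← Real.rpow_natCast (r * η) (N + 1)]
            gcongr
            · linarith
            · push_cast
              rw [hq]; linarith
      rw [Real.rpow_neg (by positivity), ← div_eq_mul_inv, div_le_div_iff₀ (by positivity)
        (by positivity)]
      linarith
    have hi := (hR.iter N).gaussIntegrable.integrable_kernel N η hr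
    have hsplit : ∫ s in Ioi 0, gaussDeriv N (η - s / r) * tailIter R b N s =
        (∫ s in Ioc 0 (r * η / 2), gaussDeriv N (η - s / r) * tailIter R b N s) +
          ∫ s in Ioi (r * η / 2), gaussDeriv N (η - s / r) * tailIter R b N s := by
      rw [← setIntegral_union (Ioc_disjoint_Ioi le_rfl) measurableSet_Ioi
        (IntegrableOn.mono_set hi Ioc_subset_Ioi_self)
        (IntegrableOn.mono_set hi (Ioi_subset_Ioi (by linarith))),
        Ioc_union_Ioi_eq_Ioi (by linarith)]
    rw [scaledIntegral, hsplit, mul_add]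
    refine (abs_add_le _ _).trans ?_
    rw [add_mul]
    refine add_le_add h1 (h2.trans ?_)
    rw [div_eq_mul_one_div, mul_assoc]
    gcongr

end PowerTail

/-! ### Half-line moments of the Gaussian -/

/-- The convolution of `s₊^m` with the Gaussian. -/
noncomputable def gaussMoment (m : ℕ) (y : ℝ) : ℝ := ∫ s in Ioi 0, gaussDeriv 0 (y - s) * s ^ m

/-- The polynomial factor of `erfc` in `gaussMoment`. -/
noncomputable def momentErfcPoly : ℕ → ℝ[X]
  | 0 => 1
  | 1 => Polynomial.X
  | m + 2 => Polynomial.X * momentErfcPoly (m + 1)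
      + Polynomial.C (((m : ℝ) + 1) / 2) * momentErfcPoly m

/-- The polynomial factor of the Gaussian in `gaussMoment`. -/
noncomputable def momentExpPoly : ℕ → ℝ[X]
  | 0 => 0
  | 1 => Polynomial.C (1 / 2)
  | m + 2 => Polynomial.X * momentExpPoly (m + 1)
      + Polynomial.C (((m : ℝ) + 1) / 2) * momentExpPoly m

lemma gaussMoment_zero (y : ℝ) : gaussMoment 0 y = √Real.pi * erfc (-y) := by
  have hpi : √Real.pi ≠ 0 := (Real.sqrt_pos.2 Real.pi_pos).ne'
  have h := (measurePreserving_sub_right volume y).setIntegral_preimage_emb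
    (MeasurableEquiv.subRight y).measurableEmbedding (fun s => Real.exp (-s ^ 2)) (Ioi (-y))
  have hs : (fun s : ℝ => s - y) ⁻¹' Ioi (-y) = Ioi 0 := by
    ext s; simp only [mem_preimage, mem_Ioi]; constructor <;> intro h <;> linarith
  rw [hs] at h
  rw [erfc, ← h, ← mul_assoc, mul_one_div_cancel hpi, one_mul, gaussMoment]
  refine integral_congr_ae (ae_of_all _ fun s => ?_)
  simp only [gaussDeriv_zero, pow_zero, mul_one]
  congr 2; ring

lemma integral_gaussDeriv_one_mul_pow (m : ℕ) (y : ℝ) :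
    ∫ s in Ioi 0, gaussDeriv 1 (y - s) * s ^ m
      = 2 * gaussMoment (m + 1) y - 2 * y * gaussMoment m y := by
  have i1 := ((gaussIntegrable_pow (m + 1)).integrable_kernel 0 y one_pos).const_mul 2
  have i2 := ((gaussIntegrable_pow m).integrable_kernel 0 y one_pos).const_mul (2 * y)
  simp only [div_one] at i1 i2
  rw [gaussMoment, gaussMoment, ← integral_const_mul, ← integral_const_mul, ← integral_sub i1 i2]
  refine integral_congr_ae (ae_of_all _ fun s => ?_)
  simp only [gaussDeriv, gaussPoly, Polynomial.derivative_one, Polynomial.eval_sub,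
    Polynomial.eval_zero, Polynomial.eval_mul, Polynomial.eval_C, Polynomial.eval_X,
    Polynomial.eval_one]
  ring

/-- Integration by parts; the factor `0 ^ m` keeps the boundary term only for m = 0. It yields all
the moment recurrences. -/
lemma integral_kernel_deriv_pow (m : ℕ) (y : ℝ) :
    ∫ s in Ioi 0, gaussDeriv 0 (y - s) * (m * s ^ (m - 1)) =
      -(Real.exp (-y ^ 2) * 0 ^ m) + (2 * gaussMoment (m + 1) y - 2 * y * gaussMoment m y) := by
  have h := GaussIntegrable.integral_kernel_mul_deriv (a := 0)
    (fun s _ => hasDerivAt_pow m s) (gaussIntegrable_pow m)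
    ((gaussIntegrable_pow (m - 1)).const_mul m)
    ((continuous_pow m).tendsto (0 : ℝ) |>.mono_left nhdsWithin_le_nhds) 0 y one_pos
  simp only [div_one, sub_zero, inv_one, one_mul, zero_add, integral_gaussDeriv_one_mul_pow,
    gaussDeriv_zero y] at h
  exact h

lemma gaussMoment_one (y : ℝ) :
    gaussMoment 1 y = y * gaussMoment 0 y + 1 / 2 * Real.exp (-y ^ 2) := by
  have h := integral_kernel_deriv_pow 0 y
  simp only [Nat.cast_zero, zero_mul, mul_zero, integral_zero, pow_zero, mul_one, zero_add] at h
  linarith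

lemma gaussMoment_add_two (m : ℕ) (y : ℝ) : gaussMoment (m + 2) y =
    y * gaussMoment (m + 1) y + ((m : ℝ) + 1) / 2 * gaussMoment m y := by
  have h := integral_kernel_deriv_pow (m + 1) y
  have h2 : ∫ s in Ioi 0, gaussDeriv 0 (y - s) * (((m + 1 : ℕ) : ℝ) * s ^ (m + 1 - 1)) =
      ((m : ℝ) + 1) * gaussMoment m y := by
    rw [gaussMoment, ← integral_const_mul]
    refine integral_congr_ae (ae_of_all _ fun s => ?_)
    simp only [add_tsub_cancel_right]
    push_cast
    ring
  rw [h2, zero_pow (by omega)] at h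
  linarith

/-- Both polynomial families obey the recurrence `gaussMoment_add_two` of the moments, so only m = 0
and m = 1 carry content. -/
lemma gaussMoment_eq (m : ℕ) (y : ℝ) : gaussMoment m y =
    √Real.pi * ((momentErfcPoly m).eval y * erfc (-y))
      + (momentExpPoly m).eval y * Real.exp (-y ^ 2) := by
  induction m using Nat.twoStepInduction with
  | zero => simp [gaussMoment_zero, momentErfcPoly, momentExpPoly]
  | one =>
    simp only [gaussMoment_one, gaussMoment_zero, momentErfcPoly, momentExpPoly,
      Polynomial.eval_X, Polynomial.eval_C]
    ring
  | more m h1 h2 =>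
    rw [gaussMoment_add_two, h1, h2]
    simp only [momentErfcPoly, momentExpPoly, Polynomial.eval_add, Polynomial.eval_mul,
      Polynomial.eval_X, Polynomial.eval_C]
    ring

lemma momentErfcPoly_eval_neg (m : ℕ) (y : ℝ) :
    (momentErfcPoly m).eval (-y) = (-1) ^ m * (momentErfcPoly m).eval y := by
  induction m using Nat.twoStepInduction with
  | zero => simp [momentErfcPoly]
  | one => simp [momentErfcPoly]
  | more m h1 h2 =>
    simp only [momentErfcPoly, Polynomial.eval_add, Polynomial.eval_mul, Polynomial.eval_X,
      Polynomial.eval_C, h1, h2]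
    ring

lemma momentExpPoly_eval_neg (m : ℕ) (y : ℝ) :
    (momentExpPoly m).eval (-y) = (-1) ^ (m + 1) * (momentExpPoly m).eval y := by
  induction m using Nat.twoStepInduction with
  | zero => simp [momentExpPoly]
  | one => simp [momentExpPoly]
  | more m h1 h2 =>
    simp only [momentExpPoly, Polynomial.eval_add, Polynomial.eval_mul, Polynomial.eval_X,
      Polynomial.eval_C, h1, h2]
    ring

lemma degree_X_mul_add_C_mul {f g : ℝ[X]} {n : ℕ} (hf : f.degree = n) (c : ℝ)
    (hg : g.degree < ((n + 1 : ℕ) : WithBot ℕ)) :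
    (Polynomial.X * f + Polynomial.C c * g).degree = ((n + 1 : ℕ) : WithBot ℕ) := by
  have h1 : (Polynomial.X * f).degree = ((n + 1 : ℕ) : WithBot ℕ) := by
    rw [Polynomial.degree_mul, Polynomial.degree_X, hf]; push_cast; rw [add_comm]
  rw [Polynomial.degree_add_eq_left_of_degree_lt, h1]
  rw [h1]
  refine lt_of_le_of_lt ?_ hg
  rw [← Polynomial.smul_eq_C_mul]
  exact Polynomial.degree_smul_le _ _

lemma degree_momentErfcPoly (m : ℕ) : (momentErfcPoly m).degree = m := by
  induction m using Nat.twoStepInduction with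
  | zero => simp [momentErfcPoly]
  | one => simp [momentErfcPoly]
  | more m h1 h2 =>
    refine degree_X_mul_add_C_mul h2 _ ?_
    rw [h1]
    exact_mod_cast (by omega : m < m + 1 + 1)

lemma degree_momentExpPoly_succ (m : ℕ) : (momentExpPoly (m + 1)).degree = m := by
  induction m using Nat.twoStepInduction with
  | zero => simp [momentExpPoly, Polynomial.degree_C]
  | one =>
    simp [momentExpPoly]
  | more m h1 h2 =>
    refine degree_X_mul_add_C_mul h2 _ ?_
    rw [h1]
    exact_mod_cast (by omega : m < m + 1 + 1)

/-- At m = 0 the polynomial is zero, of degree ⊥, matching P_{-1} = 0. -/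
lemma degree_momentExpPoly_lt (m : ℕ) : (momentExpPoly m).degree < m := by
  cases m with
  | zero => simp [momentExpPoly]
  | succ m =>
    rw [degree_momentExpPoly_succ]
    exact_mod_cast Nat.lt_succ_self m

/-! ### The contribution of one half-line -/

/-- The contribution of the positive half-line to `heatConv`. -/
noncomputable def halfConv (Λ : ℝ → ℝ) (x t : ℝ) : ℝ :=
  1 / (2 * √(Real.pi * t)) * ∫ s in Ioi 0, Λ s * Real.exp (-(s - x) ^ 2 / (4 * t))

lemma exp_eq_gaussDeriv (s x : ℝ) {t : ℝ} (ht : 0 < t) :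
    Real.exp (-(s - x) ^ 2 / (4 * t)) = gaussDeriv 0 (selfSim x t - s / (2 * √t)) := by
  rw [gaussDeriv_zero, selfSim, ← sub_div, div_pow, mul_pow, Real.sq_sqrt ht.le, neg_div]
  congr 3
  · ring
  · norm_num

lemma halfConv_eq (Λ : ℝ → ℝ) (x : ℝ) {t : ℝ} (ht : 0 < t) :
    halfConv Λ x t = (√Real.pi)⁻¹ * scaledIntegral 0 Λ (selfSim x t) (2 * √t) := by
  simp only [halfConv, scaledIntegral, exp_eq_gaussDeriv _ _ ht, mul_comm (Λ _)]
  rw [Real.sqrt_mul Real.pi_pos.le, zero_add, pow_one, ← mul_assoc (√Real.pi)⁻¹]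
  congr 1
  have := Real.sqrt_pos.2 ht
  have := Real.sqrt_pos.2 Real.pi_pos
  field_simp

lemma scaledIntegral_pow (m : ℕ) (η : ℝ) {r : ℝ} (hr : 0 < r) :
    scaledIntegral 0 (fun s => s ^ m) η r = r ^ m * gaussMoment m η := by
  rw [scaledIntegral, integral_Ioi_kernel_scale 0 _ η hr, zero_add, pow_one,
    inv_mul_cancel_left₀ hr.ne', gaussMoment, ← integral_const_mul]
  refine integral_congr_ae (ae_of_all _ fun s => ?_)
  simp only [mul_pow]; ring

/-- The remainder after removing the polynomial part of the expansion at `+∞`. -/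
noncomputable def decayingRemainder (p : ℕ) (a : ℕ → ℝ) (Λ : ℝ → ℝ) (s : ℝ) : ℝ :=
  Λ s - ∑ m ∈ Finset.range (p + 1), a (p - m) * s ^ m

lemma expansionTail_decayingRemainder (p : ℕ) (a : ℕ → ℝ) (Λ : ℝ → ℝ) (i : ℕ) {s : ℝ}
    (hs : s ≠ 0) :
    expansionTail (decayingRemainder p a Λ) (fun l => a (p + 1 + l)) i s =
      Λ s - s ^ p * ∑ n ∈ Finset.range (p + 1 + i), a n / s ^ n := by
  rw [Finset.sum_range_add, mul_add, expansionTail, decayingRemainder, Finset.mul_sum,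
    Finset.mul_sum, ← Finset.sum_range_reflect (fun n => s ^ p * (a n / s ^ n)), sub_sub]
  congr 2
  · refine Finset.sum_congr rfl fun m hm => ?_
    have hm' : m ≤ p := by have := Finset.mem_range.1 hm; omega
    rw [show p + 1 - 1 - m = p - m by omega]
    have : s ^ p = s ^ (p - m) * s ^ m := by rw [← pow_add]; congr 1; omega
    rw [this]; field_simp
  · refine Finset.sum_congr rfl fun l _ => ?_
    rw [show p + 1 + l = p + (l + 1) by ring, pow_add]
    field_simp
    ring

/-- The hypothesis controls only large s; continuity on compact intervals extends the bounds to s ≥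
1 and gives boundedness on [0, 1]. -/
lemma powerTail_decayingRemainder {p : ℕ} {a : ℕ → ℝ} {Λ : ℝ → ℝ} (hc : Continuous Λ)
    (hΛ : HasPowerExpansion atTop p a Λ) :
    PowerTail (decayingRemainder p a Λ) (fun l => a (p + 1 + l)) := by
  have hcont : Continuous (decayingRemainder p a Λ) := by
    unfold decayingRemainder; fun_prop
  have far : ∀ i : ℕ, ∃ C : ℝ, 0 ≤ C ∧ ∀ s : ℝ, 1 ≤ s →
      |expansionTail (decayingRemainder p a Λ) (fun l => a (p + 1 + l)) i s|
        ≤ C / s ^ (i + 1) := fun i => by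
    obtain ⟨C, hC⟩ := (hΛ (p + 1 + i)).bound
    obtain ⟨S, hS⟩ := eventually_atTop.1 hC
    have hcT : ContinuousOn (fun s => expansionTail (decayingRemainder p a Λ)
        (fun l => a (p + 1 + l)) i s * s ^ (i + 1)) (Icc 1 S) := by
      refine ContinuousOn.mul ?_ (by fun_prop)
      exact hcont.continuousOn.sub (continuousOn_finsetSum _ fun l _ =>
        continuousOn_const.div (by fun_prop) fun s hs => (pow_pos (by linarith [hs.1]) _).ne')
    obtain ⟨D, hD⟩ := isCompact_Icc.exists_bound_of_continuousOn hcT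
    refine ⟨max |C| |D|, by positivity, fun s hs => ?_⟩
    have hs0 : 0 < s := by linarith
    rw [le_div_iff₀ (by positivity)]
    rcases le_total s S with h | h
    · have := hD s ⟨hs, h⟩
      rw [norm_mul, Real.norm_eq_abs, Real.norm_eq_abs, abs_of_pos (pow_pos hs0 _)] at this
      exact this.trans ((le_abs_self D).trans (le_max_right _ _))
    · have := hS s h
      rw [← expansionTail_decayingRemainder p a Λ i hs0.ne', Real.norm_eq_abs, Real.norm_eq_abs,
        abs_of_pos (show 0 < s ^ p / s ^ (p + 1 + i) by positivity), show p + 1 + i = p + (i + 1) by ring, pow_add,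
        div_mul_cancel_left₀ (pow_pos hs0 p).ne', ← div_eq_mul_inv,
        le_div_iff₀ (by positivity)] at this
      exact this.trans ((le_abs_self C).trans (le_max_left _ _))
  refine ⟨hcont.continuousOn, ?_, far⟩
  obtain ⟨C, hC, h⟩ := far 0
  obtain ⟨D, hD⟩ := (isCompact_Icc (a := (0 : ℝ)) (b := 1)).exists_bound_of_continuousOn
    hcont.continuousOn
  refine ⟨max C |D|, by positivity, fun s hs => ?_⟩
  rcases le_total s 1 with h1 | h1
  · have h2 : 1 ≤ s ^ (-(1 / 2) : ℝ) :=
      Real.one_le_rpow_of_pos_of_le_one_of_nonpos hs h1 (by norm_num)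
    calc _ ≤ |D| := (hD s ⟨hs.le, h1⟩).trans (le_abs_self D)
      _ ≤ max C |D| := le_max_right _ _
      _ ≤ _ := le_mul_of_one_le_right (by positivity) h2
  · have h2 := h s h1
    simp only [expansionTail, Finset.range_zero, Finset.sum_empty, sub_zero, zero_add,
      pow_one] at h2
    have h3 : s⁻¹ ≤ s ^ (-(1 / 2) : ℝ) := by
      rw [← Real.rpow_neg_one]
      exact Real.rpow_le_rpow_of_exponent_le h1 (by norm_num)
    rw [div_eq_mul_inv] at h2
    exact h2.trans (mul_le_mul (le_max_left _ _) h3 (by positivity) (by positivity))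

lemma tendsto_sq_add_spaceTimeInfinity :
    Tendsto (fun q : ℝ × ℝ => q.1 ^ 2 + q.2) spaceTimeInfinity atTop := by
  have h1 : Tendsto (fun q : ℝ × ℝ => |q.1| + q.2 + -1) spaceTimeInfinity atTop :=
    tendsto_atTop_add_const_right _ _ (tendsto_comap.mono_left inf_le_left)
  refine tendsto_atTop_mono (fun q => ?_) h1
  nlinarith [sq_abs q.1, sq_nonneg (|q.1| - 1 / 2)]

lemma eventually_spaceTimeInfinity_pos : ∀ᶠ q : ℝ × ℝ in spaceTimeInfinity, 0 < q.2 :=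
  Eventually.filter_mono inf_le_right (mem_principal_self _)

/-- The surplus 1/4 in the exponent turns the O-estimate of the remainder into the required o. -/
lemma isLittleO_rpow_spaceTimeInfinity (N : ℕ) :
    (fun q : ℝ × ℝ => (q.1 ^ 2 + q.2) ^ (-((N : ℝ) / 2 + 1 / 4)))
      =o[spaceTimeInfinity] (fun q : ℝ × ℝ => (q.1 ^ 2 + q.2) ^ (-(N : ℝ) / 2)) := by
  have h : (fun w : ℝ => w ^ (-((N : ℝ) / 2 + 1 / 4))) =o[atTop]
      (fun w : ℝ => w ^ (-(N : ℝ) / 2)) := by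
    refine isLittleO_of_tendsto' ?_ ?_
    · filter_upwards [eventually_gt_atTop 0] with w hw h0
      exact absurd h0 (Real.rpow_pos_of_pos hw _).ne'
    · refine (tendsto_rpow_neg_atTop (y := 1 / 4) (by norm_num)).congr' ?_
      filter_upwards [eventually_gt_atTop 0] with w hw
      rw [← Real.rpow_sub hw]
      congr 1; ring
  exact h.comp_tendsto tendsto_sq_add_spaceTimeInfinity

/-- The asymptotic expansion of the contribution of the positive half-line. -/
lemma exists_halfConv_expansion {p : ℕ} {a : ℕ → ℝ} {Λ : ℝ → ℝ} (hc : Continuous Λ)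
    (hΛ : HasPowerExpansion atTop p a Λ) :
    ∃ G0 G1 : ℕ → ℝ → ℝ, (∀ n, ContDiff ℝ ∞ (G0 n) ∧ ContDiff ℝ ∞ (G1 n)) ∧ ∀ N : ℕ,
      (fun q : ℝ × ℝ => halfConv Λ q.1 q.2
        - ∑ m ∈ Finset.range (p + 1), q.2 ^ ((m : ℝ) / 2) *
            (a (p - m) * (2 ^ m / √Real.pi * gaussMoment m (selfSim q.1 q.2)))
        - decayingPart G0 G1 N q.1 q.2) =o[spaceTimeInfinity]
      (fun q : ℝ × ℝ => (q.1 ^ 2 + q.2) ^ (-(N : ℝ) / 2)) := by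
  have hR := powerTail_decayingRemainder hc hΛ
  obtain ⟨G0, G1, hG, hexp⟩ := hR.exists_expansion
  -- The constants convert r = 2√t into t: r^{-n} = 2^{-n} t^{-n/2} and log r = log 2 + (log t)/2.
  refine ⟨fun n η => (√Real.pi)⁻¹ * (2 ^ n)⁻¹ * (G0 n η + Real.log 2 * G1 n η),
    fun n η => (√Real.pi)⁻¹ * (2 ^ n)⁻¹ * (1 / 2) * G1 n η, fun n => ⟨?_, ?_⟩, fun N => ?_⟩
  · exact contDiff_const.mul ((hG n).1.add (contDiff_const.mul (hG n).2))
  · exact contDiff_const.mul (hG n).2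
  set R := decayingRemainder p a Λ with hRdef
  set b : ℕ → ℝ := fun l => a (p + 1 + l) with hb
  have key : ∀ x t : ℝ, 0 < t → halfConv Λ x t
      - ∑ m ∈ Finset.range (p + 1), t ^ ((m : ℝ) / 2) *
          (a (p - m) * (2 ^ m / √Real.pi * gaussMoment m (selfSim x t)))
      - decayingPart (fun n η => (√Real.pi)⁻¹ * (2 ^ n)⁻¹ * (G0 n η + Real.log 2 * G1 n η))
          (fun n η => (√Real.pi)⁻¹ * (2 ^ n)⁻¹ * (1 / 2) * G1 n η) N x t
      = (√Real.pi)⁻¹ * scaledIntegral N (tailIter R b N) (selfSim x t) (2 * √t) := by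
    intro x t ht
    have hst := Real.sqrt_pos.2 ht
    have hr : 0 < 2 * √t := by positivity
    have hpow : ∀ n : ℕ, (2 * √t) ^ n = 2 ^ n * t ^ ((n : ℝ) / 2) := fun n => by
      rw [mul_pow, Real.sqrt_eq_rpow, ← Real.rpow_natCast (t ^ (1 / 2 : ℝ)), ← Real.rpow_mul ht.le]
      congr 2; ring
    have hsplit : scaledIntegral 0 Λ (selfSim x t) (2 * √t) =
        scaledIntegral 0 R (selfSim x t) (2 * √t) + ∑ m ∈ Finset.range (p + 1),
          a (p - m) * scaledIntegral 0 (fun s => s ^ m) (selfSim x t) (2 * √t) := by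
      simp only [scaledIntegral]
      have i1 := hR.gaussIntegrable.integrable_kernel 0 (selfSim x t) hr
      have i2 : ∀ m ∈ Finset.range (p + 1), Integrable (fun s => a (p - m) *
          (gaussDeriv 0 (selfSim x t - s / (2 * √t)) * s ^ m)) (volume.restrict (Ioi 0)) :=
        fun m _ => ((gaussIntegrable_pow m).integrable_kernel 0 (selfSim x t) hr).const_mul _
      have e : ∀ s, gaussDeriv 0 (selfSim x t - s / (2 * √t)) * Λ s =
          gaussDeriv 0 (selfSim x t - s / (2 * √t)) * R s + ∑ m ∈ Finset.range (p + 1),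
            a (p - m) * (gaussDeriv 0 (selfSim x t - s / (2 * √t)) * s ^ m) := fun s => by
        simp only [mul_left_comm (a _), ← Finset.mul_sum, ← mul_add, hRdef, decayingRemainder,
          sub_add_cancel]
      simp only [e]
      rw [integral_add i1 (integrable_finsetSum _ i2), integral_finsetSum _ i2, mul_add,
        Finset.mul_sum]
      congr 1
      refine Finset.sum_congr rfl fun m _ => ?_
      rw [integral_const_mul, mul_left_comm]
    rw [halfConv_eq Λ x ht, hsplit, hexp N _ _ hr, decayingPart]
    simp only [scaledIntegral_pow _ _ hr]
    have e1 : ∑ n ∈ Finset.Icc 1 N, t ^ (-(n : ℝ) / 2) *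
        ((√Real.pi)⁻¹ * (2 ^ n)⁻¹ * (G0 n (selfSim x t) + Real.log 2 * G1 n (selfSim x t))
          + (√Real.pi)⁻¹ * (2 ^ n)⁻¹ * (1 / 2) * G1 n (selfSim x t) * Real.log t) =
        (√Real.pi)⁻¹ * ∑ n ∈ Finset.Icc 1 N, ((2 * √t) ^ n)⁻¹ *
          (G0 n (selfSim x t) + G1 n (selfSim x t) * Real.log (2 * √t)) := by
      rw [Finset.mul_sum]
      refine Finset.sum_congr rfl fun n _ => ?_
      rw [hpow, Real.log_mul two_ne_zero hst.ne', Real.log_sqrt ht.le, neg_div,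
        Real.rpow_neg ht.le, mul_inv]
      ring
    have e2 : ∑ m ∈ Finset.range (p + 1), t ^ ((m : ℝ) / 2) *
          (a (p - m) * (2 ^ m / √Real.pi * gaussMoment m (selfSim x t))) =
        (√Real.pi)⁻¹ * ∑ m ∈ Finset.range (p + 1),
          a (p - m) * ((2 * √t) ^ m * gaussMoment m (selfSim x t)) := by
      rw [Finset.mul_sum]
      refine Finset.sum_congr rfl fun m _ => ?_
      rw [hpow]; ring
    rw [e1, e2]
    ring
  obtain ⟨C, hC⟩ := hR.exists_abs_remainder_le N
  refine IsBigO.trans_isLittleO ?_ (isLittleO_rpow_spaceTimeInfinity N)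
  refine IsBigO.of_bound ((√Real.pi)⁻¹ * |C|) ?_
  filter_upwards [eventually_spaceTimeInfinity_pos,
    (tendsto_comap.mono_left inf_le_left :
      Tendsto (fun q : ℝ × ℝ => |q.1| + q.2) spaceTimeInfinity atTop).eventually_ge_atTop 4]
    with q hq hq4
  obtain ⟨x, t⟩ := q
  simp only at hq hq4 ⊢
  have hst := Real.sqrt_pos.2 hq
  have hsq := Real.sq_sqrt hq.le
  have hr : 0 < 2 * √t := by positivity
  have hx : 2 * √t * selfSim x t = x := by rw [selfSim]; field_simp
  -- If η > 1 and x < 2, then √t < x/2 < 1, so x + t < 3, against the threshold 4.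
  have hcase : selfSim x t ≤ 1 ∨ 2 ≤ 2 * √t * selfSim x t := by
    rw [or_iff_not_imp_left, not_le, hx]
    intro h
    have h1 : 2 * √t < x := by
      rw [selfSim, lt_div_iff₀ hr] at h; linarith
    have h2 : 0 < x := by linarith
    rw [abs_of_pos h2] at hq4
    by_contra! h3
    nlinarith
  have h1 := hC (selfSim x t) (2 * √t) hr hcase
  have h2 : (2 * √t) ^ 2 * (1 + selfSim x t ^ 2) = 4 * t + x ^ 2 := by
    rw [mul_add, ← mul_pow, hx, mul_pow, hsq]; ring
  rw [h2] at h1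
  have hpos : 0 < x ^ 2 + t := by positivity
  rw [key x t hq, norm_mul, Real.norm_eq_abs, Real.norm_eq_abs, Real.norm_eq_abs,
    abs_of_pos (inv_pos.2 (Real.sqrt_pos.2 Real.pi_pos)),
    abs_of_pos (Real.rpow_pos_of_pos hpos _), mul_assoc]
  refine mul_le_mul_of_nonneg_left (h1.trans ?_) (by positivity)
  refine mul_le_mul (le_abs_self C) ?_ (by positivity) (abs_nonneg C)
  refine Real.rpow_le_rpow_of_nonpos hpos (by linarith) ?_
  have := N.cast_nonneg (α := ℝ)
  linarith

/-! ### The heat equation -/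

lemma GaussIntegrable.of_forall_le {h : ℝ → ℝ} (hc : Continuous h)
    (hb : ∀ c : ℝ, 0 < c → ∃ C : ℝ, ∀ s, |h s| ≤ C * Real.exp (c * s ^ 2)) :
    GaussIntegrable h volume := fun c hc0 => by
  obtain ⟨C, hC⟩ := hb (c / 2) (by positivity)
  refine ((integrable_exp_neg_mul_sq (b := c / 2) (by positivity)).const_mul C).mono'
    (hc.mul (by fun_prop)).aestronglyMeasurable (ae_of_all _ fun s => ?_)
  rw [norm_mul, Real.norm_eq_abs, Real.norm_eq_abs, Real.abs_exp]
  calc _ ≤ C * Real.exp (c / 2 * s ^ 2) * Real.exp (-c * s ^ 2) := by gcongr; exact hC s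
    _ = _ := by rw [mul_assoc, ← Real.exp_add]; ring_nf

lemma GaussIntegrable.comp_mul_left {h : ℝ → ℝ} (hh : GaussIntegrable h volume) {r : ℝ}
    (hr : 0 < r) : GaussIntegrable (fun s => h (r * s)) volume := fun c hc => by
  refine ((hh (c / r ^ 2) (by positivity)).comp_mul_left' hr.ne').congr (ae_of_all _ fun s => ?_)
  simp only
  congr 2
  field_simp

lemma integral_kernel_scale (k : ℕ) (f : ℝ → ℝ) (η : ℝ) {r : ℝ} (hr : 0 < r) :
    ∫ s, gaussDeriv k (η - s / r) * f s = r * ∫ s, gaussDeriv k (η - s) * f (r * s) := by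
  have h := Measure.integral_comp_mul_left (fun s => gaussDeriv k (η - s / r) * f s) r
  simp only [smul_eq_mul, mul_div_cancel_left₀ _ hr.ne', abs_of_pos (inv_pos.2 hr)] at h
  rw [h, mul_inv_cancel_left₀ hr.ne']

lemma heatConv_eq (Λ : ℝ → ℝ) (x : ℝ) {t : ℝ} (ht : 0 < t) :
    heatConv Λ x t = (√Real.pi)⁻¹ *
      ((2 * √t)⁻¹ * ∫ s, gaussDeriv 0 (x / (2 * √t) - s / (2 * √t)) * Λ s) := by
  simp only [heatConv, exp_eq_gaussDeriv _ _ ht, mul_comm (Λ _), selfSim]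
  rw [Real.sqrt_mul Real.pi_pos.le, ← mul_assoc (√Real.pi)⁻¹]
  congr 1
  have := Real.sqrt_pos.2 ht
  have := Real.sqrt_pos.2 Real.pi_pos
  field_simp

lemma gaussDeriv_two (y : ℝ) : gaussDeriv 2 y = -2 * gaussDeriv 0 y - 2 * y * gaussDeriv 1 y := by
  simp only [gaussDeriv, gaussPoly, Polynomial.derivative_one, Polynomial.derivative_sub,
    Polynomial.derivative_mul, Polynomial.derivative_C, Polynomial.derivative_X,
    Polynomial.derivative_zero, Polynomial.eval_sub, Polynomial.eval_add,
    Polynomial.eval_zero, Polynomial.eval_mul, Polynomial.eval_C, Polynomial.eval_X,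
    Polynomial.eval_one]
  ring

/-- Here x, not η, is held fixed. The identity g'' = -2g - 2yg' of `gaussDeriv_two` turns the scale
derivative of the kernel into a second space derivative, which is the heat equation. -/
lemma GaussIntegrable.hasDerivAt_scale {h : ℝ → ℝ} (hh : GaussIntegrable h volume) (x : ℝ)
    {r : ℝ} (hr : 0 < r) :
    HasDerivAt (fun ρ => ∫ s, ρ⁻¹ * (gaussDeriv 0 (x / ρ - s / ρ) * h s))
      (∫ s, (2 * r ^ 2)⁻¹ * (gaussDeriv 2 (x / r - s / r) * h s)) r := by
  obtain ⟨C, hC, hb⟩ := exists_abs_gaussDeriv_le 2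
  have hnhds : Ioo (r / 2) (2 * r) ∈ 𝓝 r := Ioo_mem_nhds (by linarith) (by linarith)
  have hi : ∀ k : ℕ, ∀ ρ : ℝ, 0 < ρ →
      Integrable (fun s => gaussDeriv k (x / ρ - s / ρ) * h s) :=
    fun k ρ hρ => hh.integrable_kernel k _ hρ
  refine (hasDerivAt_integral_of_dominated_loc_of_deriv_le
    (F' := fun ρ s => (2 * ρ ^ 2)⁻¹ * (gaussDeriv 2 (x / ρ - s / ρ) * h s))
    -- For ρ < 2r the bound exp(-y²/2) at scale ρ is below the Gaussian at scale 3r, since 3 > 2√2.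
    (bound := fun s => (2 * (r / 2) ^ 2)⁻¹ * (C * ‖gaussDeriv 0 (x / (3 * r) - s / (3 * r)) * h s‖))
    hnhds ?_ ((hi 0 r hr).const_mul _) ((hi 2 r hr).const_mul _).aestronglyMeasurable
    (ae_of_all _ fun s ρ hρ => ?_) (((hi 0 (3 * r) (by positivity)).norm.const_mul C).const_mul _)
    (ae_of_all _ fun s ρ hρ => ?_)).2
  · filter_upwards [hnhds] with ρ hρ
    exact ((hi 0 ρ (by linarith [hρ.1])).const_mul _).aestronglyMeasurable
  · have hρ0 : 0 < ρ := by linarith [hρ.1]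
    rw [norm_mul, norm_mul, norm_mul, Real.norm_eq_abs, Real.norm_eq_abs, Real.norm_eq_abs,
      Real.norm_eq_abs, abs_of_pos (by positivity : 0 < (2 * ρ ^ 2)⁻¹), gaussDeriv_zero,
      Real.abs_exp, ← mul_assoc C]
    have h1 : (2 * ρ ^ 2)⁻¹ ≤ (2 * (r / 2) ^ 2)⁻¹ := by
      have := hρ.1.le
      gcongr
    have h2 : |gaussDeriv 2 (x / ρ - s / ρ)| ≤
        C * Real.exp (-(x / (3 * r) - s / (3 * r)) ^ 2) := by
      refine (hb _).trans ?_
      gcongr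
      rw [← sub_div, ← sub_div, div_pow, div_pow, neg_mul, neg_le_neg_iff, div_le_iff₀ (by positivity)]
      have h3 : ρ ^ 2 ≤ (2 * r) ^ 2 := by
        have := hρ.2.le
        gcongr
      have h4 : 1 / 2 * ((x - s) ^ 2 / ρ ^ 2) * (3 * r) ^ 2
          = (x - s) ^ 2 * ((9 / 2 * r ^ 2) / ρ ^ 2) := by field_simp; ring
      rw [h4]
      refine le_mul_of_one_le_right (sq_nonneg _) ?_
      rw [one_le_div (by positivity)]
      nlinarith [sq_nonneg r]
    gcongr
  · have hρ0 : ρ ≠ 0 := by have := hρ.1; intro h; linarith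
    have e1 : HasDerivAt (fun ρ : ℝ => x / ρ - s / ρ) ((x - s) * -(ρ ^ 2)⁻¹) ρ := by
      have := (hasDerivAt_inv hρ0).const_mul (x - s)
      refine this.congr_of_eventuallyEq (Eventually.of_forall fun ρ => ?_)
      simp only [div_eq_mul_inv, sub_mul]
    have e2 := (hasDerivAt_inv hρ0).mul
      (((hasDerivAt_gaussDeriv 0 (x / ρ - s / ρ)).comp ρ e1).mul_const (h s))
    refine e2.congr_deriv ?_
    simp only [Function.comp_apply, gaussDeriv_two, zero_add]
    field_simp
    ring

lemma GaussIntegrable.hasDerivAt_space {h : ℝ → ℝ} (hh : GaussIntegrable h volume) (k : ℕ) (x : ℝ)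
    {r : ℝ} (hr : 0 < r) :
    HasDerivAt (fun y => ∫ s, gaussDeriv k (y / r - s / r) * h s)
      (r⁻¹ * ∫ s, gaussDeriv (k + 1) (x / r - s / r) * h s) x := by
  simp only [integral_kernel_scale _ h _ hr]
  have h1 := (hh.comp_mul_left hr).hasDerivAt_integral k (x / r)
  have h2 := (h1.comp x ((hasDerivAt_id x).div_const r)).const_mul r
  refine h2.congr_deriv ?_
  simp only [one_div]
  ring

lemma GaussIntegrable.heat_eq {Λ : ℝ → ℝ} (hΛ : GaussIntegrable Λ volume) {t : ℝ} (ht : 0 < t) :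
    ∃ ux uxx : ℝ → ℝ, ∀ x : ℝ, HasDerivAt (fun y => heatConv Λ y t) (ux x) x ∧
      HasDerivAt ux (uxx x) x ∧ HasDerivAt (fun τ => heatConv Λ x τ) (uxx x) t := by
  have hst := Real.sqrt_pos.2 ht
  set r := 2 * √t with hr
  have hr0 : 0 < r := by positivity
  refine ⟨fun x => (√Real.pi)⁻¹ * (r⁻¹ * (r⁻¹ * ∫ s, gaussDeriv 1 (x / r - s / r) * Λ s)),
    fun x => (√Real.pi)⁻¹ * (r⁻¹ * (r⁻¹ * (r⁻¹ * ∫ s, gaussDeriv 2 (x / r - s / r) * Λ s))),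
    fun x => ⟨?_, ?_, ?_⟩⟩
  · simp only [heatConv_eq Λ _ ht]
    exact ((hΛ.hasDerivAt_space 0 x hr0).const_mul _).const_mul _
  · exact (((hΛ.hasDerivAt_space 1 x hr0).const_mul _).const_mul _).const_mul _
  · have h1 : HasDerivAt (fun τ : ℝ => 2 * √τ) (2 * (1 / (2 * √t))) t :=
      (Real.hasDerivAt_sqrt ht.ne').const_mul 2
    have h2 := (HasDerivAt.comp t (hΛ.hasDerivAt_scale x hr0) h1).const_mul (√Real.pi)⁻¹
    refine (h2.congr_of_eventuallyEq ?_).congr_deriv ?_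
    · filter_upwards [lt_mem_nhds ht] with τ hτ
      simp only [heatConv_eq Λ x hτ, Function.comp_apply, integral_const_mul]
    · rw [integral_const_mul, ← hr]
      field_simp

lemma tendsto_heatConv {Λ : ℝ → ℝ} (hc : Continuous Λ)
    (hb : ∀ c : ℝ, 0 < c → ∃ C : ℝ, ∀ s, |Λ s| ≤ C * Real.exp (c * s ^ 2)) (x : ℝ) :
    Tendsto (fun q : ℝ × ℝ => heatConv Λ q.1 q.2) (𝓝 x ×ˢ 𝓝[>] (0 : ℝ)) (𝓝 (Λ x)) := by
  -- With rate 1/4 and 2√t ≤ 1 the growth of Λ costs at most exp(z²/2), leaving half of exp(-z²) as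
  -- dominating function.
  obtain ⟨C, hC⟩ := hb (1 / 4) (by norm_num)
  have hC0 : 0 ≤ C := by simpa using (abs_nonneg _).trans (hC 0)
  have hpi : √Real.pi ≠ 0 := (Real.sqrt_pos.2 Real.pi_pos).ne'
  have htpos : ∀ᶠ q : ℝ × ℝ in 𝓝 x ×ˢ 𝓝[>] (0 : ℝ), 0 < q.2 :=
    tendsto_snd.eventually self_mem_nhdsWithin
  have hform : ∀ᶠ q : ℝ × ℝ in 𝓝 x ×ˢ 𝓝[>] (0 : ℝ),
      (√Real.pi)⁻¹ * ∫ z, gaussDeriv 0 z * Λ (q.1 - 2 * √q.2 * z) = heatConv Λ q.1 q.2 := by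
    filter_upwards [htpos] with q hq
    have hr : 0 < 2 * √q.2 := by have := Real.sqrt_pos.2 hq; positivity
    rw [heatConv_eq Λ _ hq, integral_kernel_scale 0 Λ _ hr, inv_mul_cancel_left₀ hr.ne',
      ← integral_sub_left_eq_self _ volume (q.1 / (2 * √q.2))]
    congr 1
    refine integral_congr_ae (ae_of_all _ fun z => ?_)
    simp only [sub_sub_cancel, mul_sub, mul_div_cancel₀ _ hr.ne']
  have hlim : ∫ z, gaussDeriv 0 z * Λ x = √Real.pi * Λ x := by
    rw [integral_mul_const]
    congr 1
    simpa [gaussDeriv_zero] using integral_gaussian 1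
  have hmain : Tendsto (fun q : ℝ × ℝ => ∫ z, gaussDeriv 0 z * Λ (q.1 - 2 * √q.2 * z))
      (𝓝 x ×ˢ 𝓝[>] (0 : ℝ)) (𝓝 (∫ z, gaussDeriv 0 z * Λ x)) := by
    refine tendsto_integral_filter_of_dominated_convergence
      (fun z => C * Real.exp ((|x| + 1) ^ 2 / 2) * Real.exp (-(1 / 2) * z ^ 2)) ?_ ?_ ?_ ?_
    · exact Eventually.of_forall fun q =>
        ((continuous_gaussDeriv 0).mul (hc.comp (by fun_prop))).aestronglyMeasurable
    · filter_upwards [htpos, tendsto_snd.eventually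
        (mem_nhdsWithin_of_mem_nhds (Iio_mem_nhds (show (0 : ℝ) < 1 / 4 by norm_num))),
        tendsto_fst.eventually (Metric.ball_mem_nhds x one_pos)] with q hq hq1 hq2
      refine ae_of_all _ fun z => ?_
      rw [norm_mul, Real.norm_eq_abs, Real.norm_eq_abs, gaussDeriv_zero, Real.abs_exp]
      have h1 : √q.2 ≤ 1 / 2 := by
        rw [Real.sqrt_le_left (by norm_num)]
        norm_num at hq1 ⊢
        exact hq1.le
      have h2 : |q.1| ≤ |x| + 1 := by
        have h3 : |q.1 - x| < 1 := by simpa [Real.dist_eq] using hq2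
        have h4 := abs_sub_abs_le_abs_sub q.1 x
        linarith
      have h5 : |q.1 - 2 * √q.2 * z| ≤ (|x| + 1) + |z| := by
        refine (abs_sub _ _).trans (add_le_add h2 ?_)
        rw [abs_mul, abs_of_nonneg (by positivity)]
        exact mul_le_of_le_one_left (abs_nonneg z) (by linarith)
      have h6 : (q.1 - 2 * √q.2 * z) ^ 2 ≤ 2 * (|x| + 1) ^ 2 + 2 * z ^ 2 := by
        have h7 : (q.1 - 2 * √q.2 * z) ^ 2 ≤ ((|x| + 1) + |z|) ^ 2 := by
          rw [← sq_abs (q.1 - _)]; gcongr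
        nlinarith [sq_nonneg ((|x| + 1) - |z|), sq_abs z]
      calc _ ≤ Real.exp (-z ^ 2) * (C * Real.exp (1 / 4 * (q.1 - 2 * √q.2 * z) ^ 2)) := by
            gcongr; exact hC _
        _ ≤ Real.exp (-z ^ 2) * (C * Real.exp ((|x| + 1) ^ 2 / 2 + z ^ 2 / 2)) := by
            gcongr; linarith
        _ = C * (Real.exp (-z ^ 2) * Real.exp ((|x| + 1) ^ 2 / 2 + z ^ 2 / 2)) := by ring
        _ = _ := by
            rw [mul_assoc, ← Real.exp_add, ← Real.exp_add]; ring_nf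
    · exact (integrable_exp_neg_mul_sq (by norm_num)).const_mul _
    · refine ae_of_all _ fun z => ?_
      have h1 : Tendsto (fun q : ℝ × ℝ => q.1 - 2 * √q.2 * z) (𝓝 x ×ˢ 𝓝[>] (0 : ℝ)) (𝓝 x) := by
        have h2 : Tendsto (fun q : ℝ × ℝ => q.1 - 2 * √q.2 * z) (𝓝 (x, 0)) (𝓝 x) := by
          have : Continuous fun q : ℝ × ℝ => q.1 - 2 * √q.2 * z := by fun_prop
          simpa using this.tendsto (x, 0)
        refine h2.mono_left ?_
        rw [nhds_prod_eq]
        exact Filter.prod_mono le_rfl nhdsWithin_le_nhds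
      exact (hc.tendsto x |>.comp h1).const_mul _
  have := (hmain.const_mul (√Real.pi)⁻¹).congr' hform
  rwa [hlim, inv_mul_cancel_left₀ hpi] at this

/-! ### Combination of the two half-lines -/

lemma exists_abs_le_exp_sq {p : ℕ} {Λ : ℝ → ℝ} {aMinus aPlus : ℕ → ℝ} (hc : Continuous Λ)
    (hm : HasPowerExpansion atBot p aMinus Λ) (hp : HasPowerExpansion atTop p aPlus Λ)
    {c : ℝ} (hc0 : 0 < c) : ∃ C : ℝ, ∀ s, |Λ s| ≤ C * Real.exp (c * s ^ 2) := by
  obtain ⟨E, hE, he⟩ := exists_abs_pow_le_exp_sq p hc0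
  -- The empty truncation N = 0 already says Λ = O(|x|^p).
  have hm0 := hm 0
  have hp0 := hp 0
  simp only [Finset.range_zero, Finset.sum_empty, mul_zero, sub_zero, pow_zero, div_one]
    at hm0 hp0
  obtain ⟨C, hC⟩ := hm0.bound
  obtain ⟨D, hD⟩ := hp0.bound
  obtain ⟨S, hS⟩ := eventually_atBot.1 hC
  obtain ⟨T, hT⟩ := eventually_atTop.1 hD
  obtain ⟨B, hB⟩ := (isCompact_Icc (a := S) (b := T)).exists_bound_of_continuousOn hc.continuousOn
  refine ⟨|C| * E + |D| * E + |B|, fun s => ?_⟩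
  have h1 : 1 ≤ Real.exp (c * s ^ 2) := Real.one_le_exp (by positivity)
  have hes := he s
  have hpow : ∀ K : ℝ, K * ‖s ^ p‖ ≤ |K| * E * Real.exp (c * s ^ 2) := fun K => by
    rw [norm_pow, Real.norm_eq_abs, mul_assoc]
    exact mul_le_mul (le_abs_self K) hes (by positivity) (abs_nonneg K)
  have h2 : 0 ≤ |C| * E * Real.exp (c * s ^ 2) := by positivity
  have h3 : 0 ≤ |D| * E * Real.exp (c * s ^ 2) := by positivity
  have h4 : 0 ≤ |B| * Real.exp (c * s ^ 2) := by positivity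
  rw [add_mul, add_mul]
  rcases le_total s S with hs | hs
  · have := (hS s hs).trans (hpow C)
    rw [Real.norm_eq_abs] at this
    linarith
  rcases le_total T s with ht | ht
  · have := (hT s ht).trans (hpow D)
    rw [Real.norm_eq_abs] at this
    linarith
  · have := (hB s ⟨hs, ht⟩).trans ((le_abs_self B).trans (le_mul_of_one_le_right (abs_nonneg B) h1))
    rw [Real.norm_eq_abs] at this
    linarith

lemma HasPowerExpansion.comp_neg {p : ℕ} {a : ℕ → ℝ} {Λ : ℝ → ℝ}
    (h : HasPowerExpansion atBot p a Λ) :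
    HasPowerExpansion atTop p (fun n => (-1) ^ (p + n) * a n) (fun x => Λ (-x)) := fun N => by
  have h1 := (h N).comp_tendsto tendsto_neg_atTop_atBot
  have hinv : ∀ n : ℕ, ((-1 : ℝ) ^ n)⁻¹ = (-1) ^ n := fun n => by
    rw [← inv_pow, inv_neg, inv_one]
  refine (h1.congr_left fun x => ?_).trans (IsBigO.of_bound 1 (Eventually.of_forall fun x => ?_))
  · simp only [Function.comp_apply, Finset.mul_sum]
    congr 1
    refine Finset.sum_congr rfl fun n _ => ?_
    rw [neg_pow x p, neg_pow x n, div_eq_mul_inv, mul_inv, hinv, pow_add]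
    ring
  · simp [Function.comp_apply, norm_div, norm_pow]

lemma heatConv_eq_add {Λ : ℝ → ℝ} (hΛ : GaussIntegrable Λ volume) (x : ℝ) {t : ℝ} (ht : 0 < t) :
    heatConv Λ x t = halfConv Λ x t + halfConv (fun s => Λ (-s)) (-x) t := by
  have hr : 0 < 2 * √t := by have := Real.sqrt_pos.2 ht; positivity
  have hi : Integrable (fun s => Λ s * Real.exp (-(s - x) ^ 2 / (4 * t))) := by
    simp only [exp_eq_gaussDeriv _ _ ht, mul_comm (Λ _)]
    exact hΛ.integrable_kernel 0 _ hr
  have h1 := integral_comp_neg_Ioi 0 (fun s => Λ s * Real.exp (-(s - x) ^ 2 / (4 * t)))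
  rw [neg_zero] at h1
  have h2 : ∀ s : ℝ, (-s - x) ^ 2 = (s - -x) ^ 2 := fun s => by ring
  simp only [h2] at h1
  rw [heatConv, halfConv, halfConv, h1, ← mul_add, add_comm,
    intervalIntegral.integral_Iic_add_Ioi hi.integrableOn hi.integrableOn]

lemma selfSim_neg (x t : ℝ) : selfSim (-x) t = -selfSim x t := by
  rw [selfSim, selfSim, neg_div]

lemma tendsto_neg_spaceTimeInfinity :
    Tendsto (fun q : ℝ × ℝ => (-q.1, q.2)) spaceTimeInfinity spaceTimeInfinity := by
  refine tendsto_inf.2 ⟨tendsto_comap_iff.2 ?_, ?_⟩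
  · simpa [Function.comp_def] using
      (tendsto_comap.mono_left inf_le_left :
        Tendsto (fun q : ℝ × ℝ => |q.1| + q.2) spaceTimeInfinity atTop)
  · exact tendsto_principal.2 eventually_spaceTimeInfinity_pos

/-- The polynomials multiplying `erfc` in the leading part of the expansion. -/
noncomputable def erfcPoly (m : ℕ) : ℝ[X] := Polynomial.C (2 ^ m) * momentErfcPoly m

/-- The polynomials multiplying `exp (-η²)` in the leading part of the expansion. -/
noncomputable def expPoly (p : ℕ) (aMinus aPlus : ℕ → ℝ) (m : ℕ) : ℝ[X] :=
  Polynomial.C ((aPlus (p - m) - aMinus (p - m)) * (2 ^ m / √Real.pi)) * momentExpPoly m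

lemma degree_erfcPoly (m : ℕ) : (erfcPoly m).degree = m := by
  rw [erfcPoly, Polynomial.degree_C_mul (by positivity), degree_momentErfcPoly]

/-- Reflection multiplies the coefficient by (-1)^m. This cancels the parity sign of
`momentErfcPoly` and leaves a minus sign on `momentExpPoly`, whence the difference of coefficients
in `expPoly`. -/
lemma leadingPart_eq (p : ℕ) (aMinus aPlus : ℕ → ℝ) (x t : ℝ) :
    leadingPart p aMinus aPlus erfcPoly erfcPoly (expPoly p aMinus aPlus) x t =
      ∑ m ∈ Finset.range (p + 1), t ^ ((m : ℝ) / 2) *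
          (aPlus (p - m) * (2 ^ m / √Real.pi * gaussMoment m (selfSim x t)))
        + ∑ m ∈ Finset.range (p + 1), t ^ ((m : ℝ) / 2) *
          ((-1) ^ (p + (p - m)) * aMinus (p - m) *
            (2 ^ m / √Real.pi * gaussMoment m (selfSim (-x) t))) := by
  rw [leadingPart, ← Finset.sum_add_distrib]
  refine Finset.sum_congr rfl fun m hm => ?_
  have hm' : m ≤ p := by have := Finset.mem_range.1 hm; omega
  have hsgn : (-1 : ℝ) ^ (p + (p - m)) = (-1) ^ m := by
    rw [show p + (p - m) = 2 * (p - m) + m by omega, pow_add, pow_mul]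
    simp
  have hsq : ((-1 : ℝ) ^ m) ^ 2 = 1 := by rw [← pow_mul, mul_comm, pow_mul]; simp
  have hpi : √Real.pi ≠ 0 := (Real.sqrt_pos.2 Real.pi_pos).ne'
  simp only [erfcPoly, expPoly, Polynomial.eval_mul, Polynomial.eval_C, hsgn, gaussMoment_eq,
    selfSim_neg, neg_neg, neg_sq, momentErfcPoly_eval_neg, momentExpPoly_eval_neg, pow_succ (-1 : ℝ) m]
  rw [← mul_add]
  congr 1
  generalize (-1 : ℝ) ^ m = ε at hsq
  generalize selfSim x t = η
  field_simp
  linear_combination (-aMinus (p - m) * erfc η * Polynomial.eval η (momentErfcPoly m) * √Real.pi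
    + aMinus (p - m) * Polynomial.eval η (momentExpPoly m) * Real.exp (-η ^ 2)) * hsq

end HeatAsymptotics

theorem mainTheorem2 :
    ∃ PiMinus PiPlus : ℕ → ℝ[X],
      (∀ m : ℕ, (PiMinus m).degree = (m : WithBot ℕ) ∧ (PiPlus m).degree = (m : WithBot ℕ)) ∧
      ∀ (p : ℕ) (Λ : ℝ → ℝ) (aMinus aPlus : ℕ → ℝ),
        Continuous Λ →
        HeatAsymptotics.HasPowerExpansion atBot p aMinus Λ →
        HeatAsymptotics.HasPowerExpansion atTop p aPlus Λ →
        (∀ x t : ℝ, 0 < t →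
          Integrable (fun s : ℝ => Λ s * Real.exp (-(s - x) ^ 2 / (4 * t)))) ∧
        HeatAsymptotics.IsHeatSolution Λ (HeatAsymptotics.heatConv Λ) ∧
        ∃ (P : ℕ → ℝ[X]) (G0 G1 : ℕ → ℝ → ℝ),
          (∀ m : ℕ, m ≤ p → (P m).degree < (m : WithBot ℕ)) ∧
          (∀ m : ℕ, 1 ≤ m → m ≤ p → aMinus (p - m) ≠ aPlus (p - m) →
            (P m).degree = ((m - 1 : ℕ) : WithBot ℕ)) ∧
          (∀ n : ℕ, 1 ≤ n → ContDiff ℝ ∞ (G0 n) ∧ ContDiff ℝ ∞ (G1 n)) ∧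
          ∀ N : ℕ,
            (fun q : ℝ × ℝ =>
              HeatAsymptotics.heatConv Λ q.1 q.2
                - HeatAsymptotics.leadingPart p aMinus aPlus PiMinus PiPlus P q.1 q.2
                - HeatAsymptotics.decayingPart G0 G1 N q.1 q.2)
            =o[HeatAsymptotics.spaceTimeInfinity]
              (fun q : ℝ × ℝ => (q.1 ^ 2 + q.2) ^ (-(N : ℝ) / 2)) := by
  open HeatAsymptotics in
  refine ⟨erfcPoly, erfcPoly, fun m => ⟨degree_erfcPoly m, degree_erfcPoly m⟩,
    fun p Λ aMinus aPlus hc hm hp => ?_⟩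
  have hb : ∀ c : ℝ, 0 < c → ∃ C : ℝ, ∀ s, |Λ s| ≤ C * Real.exp (c * s ^ 2) :=
    fun c hc0 => exists_abs_le_exp_sq hc hm hp hc0
  have hΛ := GaussIntegrable.of_forall_le hc hb
  refine ⟨fun x t ht => ?_, ⟨fun t ht => hΛ.heat_eq ht, tendsto_heatConv hc hb⟩, ?_⟩
  · simp only [exp_eq_gaussDeriv _ _ ht, mul_comm (Λ _)]
    exact hΛ.integrable_kernel 0 _ (by have := Real.sqrt_pos.2 ht; positivity)
  obtain ⟨G0, G1, hG, hGexp⟩ := exists_halfConv_expansion hc hp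
  obtain ⟨H0, H1, hH, hHexp⟩ := exists_halfConv_expansion (hc.comp continuous_neg) hm.comp_neg
  refine ⟨expPoly p aMinus aPlus, fun n η => G0 n η + H0 n (-η), fun n η => G1 n η + H1 n (-η),
    fun m _ => ?_, fun m hm1 _ hne => ?_, fun n _ => ⟨?_, ?_⟩, fun N => ?_⟩
  · refine lt_of_le_of_lt ?_ (degree_momentExpPoly_lt m)
    rw [expPoly, ← Polynomial.smul_eq_C_mul]
    exact Polynomial.degree_smul_le _ _
  · obtain ⟨k, rfl⟩ : ∃ k, m = k + 1 := ⟨m - 1, by omega⟩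
    have h1 : (aPlus (p - (k + 1)) - aMinus (p - (k + 1))) * (2 ^ (k + 1) / √Real.pi) ≠ 0 :=
      mul_ne_zero (sub_ne_zero.2 hne.symm) (by have := Real.pi_pos; positivity)
    rw [expPoly, Polynomial.degree_C_mul h1, degree_momentExpPoly_succ, add_tsub_cancel_right]
  · exact (hG n).1.add ((hH n).1.comp contDiff_neg)
  · exact (hG n).2.add ((hH n).2.comp contDiff_neg)
  · have h2 := (hHexp N).comp_tendsto tendsto_neg_spaceTimeInfinity
    simp only [Function.comp_def, neg_sq] at h2
    refine ((hGexp N).add h2).congr' ?_ EventuallyEq.rfl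
    filter_upwards [eventually_spaceTimeInfinity_pos] with q hq
    rw [heatConv_eq_add hΛ q.1 hq, leadingPart_eq]
    have h3 : decayingPart (fun n η => G0 n η + H0 n (-η)) (fun n η => G1 n η + H1 n (-η)) N
        q.1 q.2 = decayingPart G0 G1 N q.1 q.2 + decayingPart H0 H1 N (-q.1) q.2 := by
      simp only [decayingPart, ← Finset.sum_add_distrib, selfSim_neg]
      refine Finset.sum_congr rfl fun n _ => ?_
      ring
    rw [h3]
    ring
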